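/- \textbf{Darboux theorem for $k$-symplectic manifolds.} Let $n,k\ge 0$ be integers and let $M$ be a smooth ($\mathscr C^\infty$) real manifold of dimension $n(k+1)$, without boundary. Let $(\omega^1,\dots,\omega^k,V)$ be a $k$-symplectic structure on $M$, that is: $\omega^1,\dots,\omega^k$ are smooth closed differential $2$-forms on $M$, and $V\subset \mathrm{T}M$ is a smooth distribution of constant rank $nk$ which is integrable (through every point of $M$ there passes an integral manifold of $V$, i.e. an immersed submanifold whose tangent space at each of its points $y$ is $V_y$), such that \begin{enumerate} \item $\omega^\alpha|_{V\times V}=0$ for $1\le\alpha\le k$, \item $\bigcap_{\alpha=1}^k\ker\omega^\alpha=\{0\}$, where $\ker\omega^\alpha=\{v\in \mathrm{T}M : \omega^\alpha(v,\cdot)=0\}$. \end{enumerate} Then around every point $x\in M$ there exist smooth local coordinates $\{q^i,p^\alpha_i\}$, with $1\le i\le n$ and $1\le\alpha\le k$, such that on their whole domain $$\omega^\alpha=\sum_{i=1}^n \mathrm{d}q^i\wedge \mathrm{d}p^\alpha_i\quad(1\le\alpha\le k),\qquad V=\left\langle \frac{\partial}{\partial p^\alpha_i}\right\rangle_{i=1,\dots,n,\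 \alpha=1,\dots,k}.$$ -/

import Mathlib

open scoped Manifold ContDiff Topology

/-- A (not necessarily continuous) field of alternating bilinear forms on the tangent spaces of an
`m`-dimensional manifold `M`; see `IsSmoothForm` for smooth differential two-forms. -/
abbrev TwoFormField (m : ℕ) (M : Type*) [TopologicalSpace M]
    [ChartedSpace (EuclideanSpace ℝ (Fin m)) M] : Type _ :=
  (x : M) → TangentSpace (𝓡 m) x [⋀^Fin 2]→L[ℝ] ℝ

/-- A field of linear subspaces of the tangent spaces, i.e. a (generalised) distribution. -/
abbrev SubspaceField (m : ℕ) (M : Type*) [TopologicalSpace M]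
    [ChartedSpace (EuclideanSpace ℝ (Fin m)) M] : Type _ :=
  (x : M) → Submodule ℝ (TangentSpace (𝓡 m) x)

section

variable {m : ℕ} {M : Type*} [TopologicalSpace M] [ChartedSpace (EuclideanSpace ℝ (Fin m)) M]

/-- The expression of a two-form in a chart `e`: the pullback of `Ω` along `e.symm`, a two-form on
the open set `e.target` of `ℝ^m`. -/
noncomputable def TwoFormField.inChart (Ω : TwoFormField m M)
    (e : OpenPartialHomeomorph M (EuclideanSpace ℝ (Fin m))) (u : EuclideanSpace ℝ (Fin m)) :
    EuclideanSpace ℝ (Fin m) [⋀^Fin 2]→L[ℝ] ℝ :=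
  (Ω (e.symm u)).compContinuousLinearMap (mfderiv (𝓡 m) (𝓡 m) e.symm u)

/-- `Ω` is a smooth differential two-form: its coefficients in every chart are smooth. -/
def TwoFormField.IsSmoothForm (Ω : TwoFormField m M) : Prop :=
  ∀ e ∈ atlas (EuclideanSpace ℝ (Fin m)) M, ContDiffOn ℝ ∞ (Ω.inChart e) e.target

/-- `Ω` is closed: `dΩ = 0`, the exterior derivative being computed in charts. -/
def TwoFormField.IsClosedForm (Ω : TwoFormField m M) : Prop :=
  ∀ e ∈ atlas (EuclideanSpace ℝ (Fin m)) M, ∀ u ∈ e.target, extDeriv (Ω.inChart e) u = 0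

/-- The distribution `V` is smooth: around every point it is spanned by finitely many smooth local
vector fields. -/
def SubspaceField.IsSmoothDistribution [IsManifold (𝓡 m) ∞ M] (V : SubspaceField m M) : Prop :=
  ∀ x : M, ∃ U : Set M, IsOpen U ∧ x ∈ U ∧
    ∃ (l : ℕ) (X : Fin l → (y : M) → TangentSpace (𝓡 m) y),
      (∀ j, ContMDiffOn (𝓡 m) (𝓡 m).tangent ∞
        (fun y ↦ (⟨y, X j y⟩ : TangentBundle (𝓡 m) M)) U) ∧
      ∀ y ∈ U, V y = Submodule.span ℝ (Set.range fun j ↦ X j y)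

/-- The distribution `V` has constant rank `r`. -/
def SubspaceField.HasRank (V : SubspaceField m M) (r : ℕ) : Prop :=
  ∀ x : M, Module.finrank ℝ (V x) = r

/-- The distribution `V` of rank `r` is integrable: through every point `x` of `M` there passes an
integral manifold of `V`, that is, an (immersed) submanifold whose tangent space at each of its
points `y` is `V y`. The submanifold is given near `x` by an injective immersion `f` of an open
neighbourhood `U` of `0` in `ℝ^r` with `f 0 = x`. -/
def SubspaceField.IsIntegrable (V : SubspaceField m M) (r : ℕ) : Prop :=
  ∀ x : M, ∃ (U : Set (EuclideanSpace ℝ (Fin r))) (f : EuclideanSpace ℝ (Fin r) → M),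
    IsOpen U ∧ 0 ∈ U ∧ f 0 = x ∧ Set.InjOn f U ∧ ContMDiffOn (𝓡 r) (𝓡 m) ∞ f U ∧
    ∀ u ∈ U, Function.Injective (mfderiv (𝓡 r) (𝓡 m) f u) ∧
      LinearMap.range (mfderiv (𝓡 r) (𝓡 m) f u).toLinearMap = V (f u)

end

/-- `(Ω^1, …, Ω^k, V)` is a `k`-symplectic structure on the `n(k+1)`-dimensional manifold `M`. -/
structure IsKSymplectic {n k : ℕ} {M : Type*} [TopologicalSpace M]
    [ChartedSpace (EuclideanSpace ℝ (Fin (n * (k + 1)))) M]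
    [IsManifold (𝓡 (n * (k + 1))) ∞ M]
    (Ω : Fin k → TwoFormField (n * (k + 1)) M) (V : SubspaceField (n * (k + 1)) M) : Prop where
  smooth_form : ∀ α, (Ω α).IsSmoothForm
  closed_form : ∀ α, (Ω α).IsClosedForm
  smooth_distribution : V.IsSmoothDistribution
  rank_distribution : V.HasRank (n * k)
  integrable_distribution : V.IsIntegrable (n * k)
  /-- `Ω^α` vanishes on `V × V`. -/
  isotropic : ∀ (α : Fin k) (x : M), ∀ v ∈ V x, ∀ w ∈ V x, Ω α x ![v, w] = 0
  /-- The kernels of `Ω^1, …, Ω^k` intersect in `0`. -/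
  ker_inter : ∀ (x : M) (v : TangentSpace (𝓡 (n * (k + 1))) x),
    (∀ (α : Fin k) (w : TangentSpace (𝓡 (n * (k + 1))) x), Ω α x ![v, w] = 0) → v = 0

/-- The space `ℝ^n × (ℝ^n)^k` of values of the coordinates `(q^i, p^α_i)`. -/
abbrev DarbouxSpace (n k : ℕ) : Type := (Fin n → ℝ) × (Fin k → Fin n → ℝ)

section

variable {n k m : ℕ} {M : Type*} [TopologicalSpace M] [ChartedSpace (EuclideanSpace ℝ (Fin m)) M]

/-- `φ` is a smooth local coordinate system on its domain: a diffeomorphism of the open set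
`φ.source` of `M` onto the open set `φ.target`. -/
def IsCoordinateSystem (φ : OpenPartialHomeomorph M (DarbouxSpace n k)) : Prop :=
  ContMDiffOn (𝓡 m) 𝓘(ℝ, DarbouxSpace n k) ∞ φ φ.source ∧
    ContMDiffOn 𝓘(ℝ, DarbouxSpace n k) (𝓡 m) ∞ φ.symm φ.target

/-- The covector `dq^i` at `y`. -/
noncomputable def dq (φ : OpenPartialHomeomorph M (DarbouxSpace n k)) (i : Fin n) (y : M) :
    TangentSpace (𝓡 m) y →L[ℝ] ℝ :=
  mfderiv (𝓡 m) 𝓘(ℝ, ℝ) (fun z ↦ (φ z).1 i) y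

/-- The covector `dp^α_i` at `y`. -/
noncomputable def dp (φ : OpenPartialHomeomorph M (DarbouxSpace n k)) (α : Fin k) (i : Fin n)
    (y : M) : TangentSpace (𝓡 m) y →L[ℝ] ℝ :=
  mfderiv (𝓡 m) 𝓘(ℝ, ℝ) (fun z ↦ (φ z).2 α i) y

/-- The coordinate vector `∂/∂p^α_i` at `y`. -/
noncomputable def partialP (φ : OpenPartialHomeomorph M (DarbouxSpace n k)) (α : Fin k) (i : Fin n)
    (y : M) : TangentSpace (𝓡 m) y :=
  mfderiv 𝓘(ℝ, DarbouxSpace n k) (𝓡 m) (fun s : DarbouxSpace n k ↦ φ.symm s) (φ y)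
    ((0, Pi.single α (Pi.single i 1)) : DarbouxSpace n k)

end

/-!
# The Darboux theorem for `k`-symplectic manifolds

In a chart the problem concerns closed two-forms `ω^α` and a distribution `V` of rank `nk` on an
open subset of a vector space `Z`.

*Straightening `V`.* Near a point `p`, the distribution has a smooth frame
`L(z) : V p → V z` normalised by a linear projection onto `V p`. Since `V` has an integral manifold
through every point, the vector fields `L(·) y` commute: along an integral manifold `f` one has
`Df = L(f) ∘ π ∘ Df`, and the second derivative of `f` is symmetric
(`commute_of_integral_manifold`). Following these fields up to time `1` from a transversal through
`p` gives coordinates `(s, y)` in which `V` is tangent to the fibres `{s} × V p`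
(`exists_coordinates_of_commuting_frame`). The smooth dependence of the flow on initial points and
parameters comes from the inverse function theorem in the Banach space `C([0, 1], Z)`
(`exists_parametric_flow`), because `γ ↦ X ∘ γ` is a smooth map between spaces of continuous
curves (`ContinuousMap.contDiff_infty_comp_left`).

*The momenta.* As `ω^α` vanishes on pairs of vectors tangent to the fibres, contracting along the
fibres and then to the origin yields a primitive `θ^α` of `ω^α` that vanishes on the
fibre directions (`exists_primitive_of_isotropic_fibres`). Hence `-θ^α = ∑ᵢ p^α_i dq^i`, where the
`q^i` are the coordinates `s`, and `ω^α = ∑ᵢ dq^i ∧ dp^α_i`. The common kernel of the `dq^i` and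
`dp^α_i` lies in the common kernel of the `ω^α`, which is zero; since there are `n(k + 1)` of these
functions, they form a coordinate system (`exists_darboux_coordinates_of_fibres`).
-/

universe u

/-! ### Smooth maps between spaces of curves, and the flow of small vector fields -/

/-- The inverse function theorem, with a local inverse smooth on its whole domain. The source is cut
down to points where the derivative is invertible, because `ContDiffAt ℝ ∞` at the single point
`f a` would not give a neighbourhood on which the local inverse is smooth. -/
theorem ContDiffOn.exists_openPartialHomeomorph {E F : Type*} [NormedAddCommGroup E]
    [NormedSpace ℝ E] [CompleteSpace E] [NormedAddCommGroup F] [NormedSpace ℝ F]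
    {f : E → F} {W : Set E} (hW : IsOpen W) (hf : ContDiffOn ℝ ∞ f W) {a : E} (ha : a ∈ W)
    {f' : E ≃L[ℝ] F} (hf' : HasFDerivAt f (f' : E →L[ℝ] F) a) :
    ∃ e : OpenPartialHomeomorph E F, a ∈ e.source ∧ e.source ⊆ W ∧ (e : E → F) = f ∧
      ContDiffOn ℝ ∞ e.symm e.target ∧
      ∀ z ∈ e.source, ∃ g : E ≃L[ℝ] F, HasFDerivAt f (g : E →L[ℝ] F) z := by
  have hfa : ContDiffAt ℝ ∞ f a := hf.contDiffAt (hW.mem_nhds ha)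
  set e₀ := hfa.toOpenPartialHomeomorph f hf' (by simp)
  have hcont : ContinuousOn (fderiv ℝ f) W :=
    hf.continuousOn_fderiv_of_isOpen hW (by simp)
  set W' : Set E := W ∩ fderiv ℝ f ⁻¹' Set.range ((↑) : (E ≃L[ℝ] F) → E →L[ℝ] F)
  have hW' : IsOpen W' := hcont.isOpen_inter_preimage hW ContinuousLinearEquiv.isOpen
  have haW' : a ∈ W' := ⟨ha, f', hf'.fderiv.symm⟩
  have key : ∀ z ∈ W', ∃ g : E ≃L[ℝ] F, HasFDerivAt f (g : E →L[ℝ] F) z := by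
    rintro z ⟨hz, g, hg⟩
    refine ⟨g, hg ▸ ?_⟩
    exact ((hf.contDiffAt (hW.mem_nhds hz)).differentiableAt (by simp)).hasFDerivAt
  refine ⟨e₀.restrOpen W' hW', ⟨hfa.mem_toOpenPartialHomeomorph_source hf' (by simp), haW'⟩,
    fun z hz ↦ hz.2.1, rfl, ?_, fun z hz ↦ key z hz.2⟩
  intro w hw
  have hw' := (e₀.restrOpen W' hW').map_target hw
  obtain ⟨g, hg⟩ := key _ hw'.2
  exact ((e₀.restrOpen W' hW').contDiffAt_symm hw hg
    (hf.contDiffAt (hW.mem_nhds hw'.2.1))).contDiffWithinAt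

section Superposition

variable {K : Type*} [TopologicalSpace K] [CompactSpace K]

/-- Pointwise application of a continuous family of continuous linear maps to a continuous family
of vectors, as a continuous linear map. -/
noncomputable def ContinuousMap.pointwiseCLM (K : Type*) [TopologicalSpace K] [CompactSpace K]
    (E F : Type*) [NormedAddCommGroup E] [NormedSpace ℝ E] [NormedAddCommGroup F]
    [NormedSpace ℝ F] : C(K, E →L[ℝ] F) →L[ℝ] C(K, E) →L[ℝ] C(K, F) :=
  LinearMap.mkContinuous₂
    (LinearMap.mk₂ ℝ (fun (A : C(K, E →L[ℝ] F)) (γ : C(K, E)) ↦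
      (⟨fun t ↦ A t (γ t), by fun_prop⟩ : C(K, F)))
      (fun _ _ _ ↦ by ext; simp) (fun _ _ _ ↦ by ext; simp) (fun _ _ _ ↦ by ext; simp)
      (fun _ _ _ ↦ by ext; simp)) 1 (fun A γ ↦ by
      refine (ContinuousMap.norm_le _ (by positivity)).2 fun t ↦ ?_
      have h1 := A.norm_coe_le_norm t
      have h2 := γ.norm_coe_le_norm t
      simp only [one_mul, LinearMap.mk₂_apply, ContinuousMap.coe_mk]
      exact ((A t).le_opNorm _).trans (by gcongr))

@[simp]
theorem ContinuousMap.pointwiseCLM_apply {E F : Type*} [NormedAddCommGroup E] [NormedSpace ℝ E]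
    [NormedAddCommGroup F] [NormedSpace ℝ F] (A : C(K, E →L[ℝ] F)) (γ : C(K, E)) (t : K) :
    ContinuousMap.pointwiseCLM K E F A γ t = A t (γ t) := rfl

theorem ContinuousMap.exists_forall_dist_comp_lt {E F : Type*} [PseudoMetricSpace E]
    [PseudoMetricSpace F] (f : C(E, F)) (γ : C(K, E)) {ε : ℝ} (hε : 0 < ε) :
    ∃ δ > 0, ∀ ⦃γ' : C(K, E)⦄, dist γ' γ < δ → dist (f.comp γ') (f.comp γ) < ε := by
  have hb : Metric.ball (f.comp γ) ε ∈ 𝓝 (f.comp γ) := Metric.ball_mem_nhds _ hε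
  have hc : Continuous (fun γ : C(K, E) ↦ f.comp γ) := ContinuousMap.continuous_postcomp f
  exact Metric.eventually_nhds_iff.1 (hc.continuousAt hb)

/-- The superposition operator `γ ↦ f ∘ γ` is differentiable when `f` is continuously
differentiable: its derivative at `γ` is pointwise application of `f' ∘ γ`. -/
theorem ContinuousMap.hasFDerivAt_comp_left {E F : Type*} [NormedAddCommGroup E] [NormedSpace ℝ E]
    [NormedAddCommGroup F] [NormedSpace ℝ F] (f : C(E, F)) (f' : C(E, E →L[ℝ] F))
    (hf : ∀ z, HasFDerivAt f (f' z) z) (γ : C(K, E)) :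
    HasFDerivAt (fun γ : C(K, E) ↦ f.comp γ) (ContinuousMap.pointwiseCLM K E F (f'.comp γ)) γ := by
  rw [hasFDerivAt_iff_isLittleO_nhds_zero, Asymptotics.isLittleO_iff]
  intro ε hε
  obtain ⟨δ, hδ, H⟩ := ContinuousMap.exists_forall_dist_comp_lt f' γ hε
  filter_upwards [Metric.ball_mem_nhds (0 : C(K, E)) hδ] with h hh
  refine (ContinuousMap.norm_le _ (by positivity)).2 fun t ↦ ?_
  simp only [ContinuousMap.sub_apply, ContinuousMap.comp_apply, ContinuousMap.add_apply,
    ContinuousMap.pointwiseCLM_apply]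
  have hht : ‖h t‖ ≤ ‖h‖ := h.norm_coe_le_norm t
  rw [mem_ball_zero_iff] at hh
  have bound : ∀ z ∈ Metric.closedBall (γ t) ‖h t‖, ‖f' z - f' (γ t)‖ ≤ ε := by
    intro z hz
    rw [mem_closedBall_iff_norm] at hz
    -- constant perturbations of `γ` reduce the pointwise bound to the uniform one
    have hd : dist (γ + ContinuousMap.const K (z - γ t)) γ < δ := by
      rw [dist_eq_norm, add_sub_cancel_left]
      refine lt_of_le_of_lt ((ContinuousMap.norm_le _ (norm_nonneg _)).2 fun s ↦ ?_) hh
      exact hz.trans hht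
    have := (ContinuousMap.dist_apply_le_dist t).trans (H hd).le
    simpa [dist_eq_norm] using this
  have := (convex_closedBall (γ t) ‖h t‖).norm_image_sub_le_of_norm_hasFDerivWithin_le'
    (fun z _ ↦ (hf z).hasFDerivWithinAt) bound (Metric.mem_closedBall_self (norm_nonneg _))
    (y := γ t + h t) (by simp)
  rw [add_sub_cancel_left] at this
  exact this.trans (by gcongr)

/-- The superposition operator of a `C^n` function is `C^n`, by induction on `n`. The derivative of
`γ ↦ f ∘ γ` is a continuous linear function of `γ ↦ f' ∘ γ`; as the target of `f'` is `E →L[ℝ] F`,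
the induction needs `E` and `F` in the same universe. -/
theorem ContinuousMap.contDiff_comp_left {E : Type u} [NormedAddCommGroup E] [NormedSpace ℝ E]
    (n : ℕ) : ∀ {F : Type u} [NormedAddCommGroup F] [NormedSpace ℝ F] (f : C(E, F)),
    ContDiff ℝ n f → ContDiff ℝ n (fun γ : C(K, E) ↦ f.comp γ) := by
  induction n with
  | zero =>
    intro F _ _ f _
    exact contDiff_zero.2 (ContinuousMap.continuous_postcomp f)
  | succ n ih =>
    intro F _ _ f hf
    have hf1 : ContDiff ℝ n (fderiv ℝ f) := by
      have := contDiff_succ_iff_fderiv.1 (by exact_mod_cast hf : ContDiff ℝ ((n : ℕ∞ω) + 1) f)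
      exact this.2.2
    let f' : C(E, E →L[ℝ] F) := ⟨fderiv ℝ f, hf1.continuous⟩
    refine contDiff_succ_iff_hasFDerivAt.2 ⟨fun γ ↦ ContinuousMap.pointwiseCLM K E F (f'.comp γ),
      (ContinuousLinearMap.contDiff _).comp (ih f' hf1), fun γ ↦ ?_⟩
    exact ContinuousMap.hasFDerivAt_comp_left f f'
      (fun z ↦ (hf.differentiable (by simp) z).hasFDerivAt) γ

theorem ContinuousMap.contDiff_infty_comp_left {E F : Type u} [NormedAddCommGroup E]
    [NormedSpace ℝ E] [NormedAddCommGroup F] [NormedSpace ℝ F] (f : C(E, F))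
    (hf : ContDiff ℝ ∞ f) : ContDiff ℝ ∞ (fun γ : C(K, E) ↦ f.comp γ) :=
  contDiff_infty.2 fun n ↦ ContinuousMap.contDiff_comp_left n f (contDiff_infty.1 hf n)

end Superposition

section Primitive

open MeasureTheory

/-- The operator sending a continuous curve `γ` on `[0, 1]` to its primitive `t ↦ ∫₀ᵗ γ`. -/
noncomputable def ContinuousMap.primitiveCLM (E : Type*) [NormedAddCommGroup E] [NormedSpace ℝ E] :
    C(unitInterval, E) →L[ℝ] C(unitInterval, E) :=
  LinearMap.mkContinuous
    { toFun := fun γ ↦ ⟨fun t ↦ ∫ s in (0 : ℝ)..t, Set.IccExtend zero_le_one γ s,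
        (intervalIntegral.continuous_primitive
          (fun a b ↦ γ.continuous.Icc_extend'.intervalIntegrable a b) 0).comp
          continuous_subtype_val⟩
      map_add' := fun γ γ' ↦ by
        ext t
        have h1 := (γ.continuous.Icc_extend' (h := zero_le_one)).intervalIntegrable
          (μ := volume) 0 (t : ℝ)
        have h2 := (γ'.continuous.Icc_extend' (h := zero_le_one)).intervalIntegrable
          (μ := volume) 0 (t : ℝ)
        simpa [Set.IccExtend] using intervalIntegral.integral_add h1 h2
      map_smul' := fun c γ ↦ by
        ext t
        simp [Set.IccExtend] } 1 (fun γ ↦ by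
      refine (ContinuousMap.norm_le _ (by positivity)).2 fun t ↦ ?_
      refine (intervalIntegral.norm_integral_le_of_norm_le_const (C := ‖γ‖)
        fun s _ ↦ γ.norm_coe_le_norm _).trans ?_
      have := t.2.1
      have := t.2.2
      rw [sub_zero, abs_of_nonneg t.2.1]
      nlinarith [norm_nonneg γ])

/-- A parametric integral over `[0, 1]` of a smooth function is smooth, and can be differentiated
under the integral sign. The integrand is regarded as a curve in `C([0, 1], F)` depending smoothly
on the parameter. -/
theorem contDiff_integral_unitInterval {E F : Type u} [NormedAddCommGroup E] [NormedSpace ℝ E]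
    [NormedAddCommGroup F] [NormedSpace ℝ F] {g : ℝ → E → F}
    (hg : ContDiff ℝ ∞ (fun x : ℝ × E ↦ g x.1 x.2)) :
    ContDiff ℝ ∞ (fun z ↦ ∫ t in (0 : ℝ)..1, g t z) ∧
      ∀ z w, fderiv ℝ (fun z ↦ ∫ t in (0 : ℝ)..1, g t z) z w =
        ∫ t in (0 : ℝ)..1, fderiv ℝ (g t) z w := by
  let gc : C(ℝ × E, F) := ⟨fun x ↦ g x.1 x.2, hg.continuous⟩
  let g' : C(ℝ × E, ℝ × E →L[ℝ] F) := ⟨fderiv ℝ gc, hg.continuous_fderiv (by simp)⟩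
  let b : C(unitInterval, ℝ × E) := ⟨fun t ↦ (t, 0), by fun_prop⟩
  let A : E →L[ℝ] C(unitInterval, ℝ × E) :=
    ContinuousLinearMap.const (R := ℝ) (M := ℝ × E) unitInterval ∘L .inr ℝ ℝ E
  let T : C(unitInterval, F) →L[ℝ] F :=
    ContinuousMap.evalCLM ℝ 1 ∘L ContinuousMap.primitiveCLM F
  have hT : ∀ (h : ℝ → F) (γ : C(unitInterval, F)), (∀ t : unitInterval, γ t = h t) →
      T γ = ∫ t in (0 : ℝ)..1, h t := by
    intro h γ hγ
    change ∫ s in (0 : ℝ)..1, Set.IccExtend zero_le_one γ s = _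
    refine intervalIntegral.integral_congr fun t ht ↦ ?_
    rw [Set.uIcc_of_le zero_le_one] at ht
    simp only [Set.IccExtend_of_mem zero_le_one γ ht, hγ]
  have hcA : ContDiff ℝ ∞ (fun z ↦ b + A z) := contDiff_const.add A.contDiff
  have hJ : (fun z ↦ ∫ t in (0 : ℝ)..1, g t z) = fun z ↦ T (gc.comp (b + A z)) := by
    ext z
    exact (hT _ _ fun t ↦ by simp [gc, b, A]).symm
  rw [hJ]
  refine ⟨T.contDiff.comp ((ContinuousMap.contDiff_infty_comp_left gc hg).comp hcA),
    fun z w ↦ ?_⟩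
  have h1 := ContinuousMap.hasFDerivAt_comp_left gc g'
    (fun x ↦ (hg.differentiable (by simp) x).hasFDerivAt) (b + A z)
  have h2 : HasFDerivAt (fun z ↦ b + A z) A z := A.hasFDerivAt.const_add b
  have h6 := (T.hasFDerivAt.comp z (h1.comp z h2)).fderiv
  change fderiv ℝ (T ∘ ((fun γ ↦ gc.comp γ) ∘ fun z ↦ b + A z)) z w = _
  rw [h6]
  refine hT _ _ fun t ↦ ?_
  have h3 : HasFDerivAt (fun z : E ↦ ((t : ℝ), z)) (.inr ℝ ℝ E) z :=
    (hasFDerivAt_const _ _).prodMk (hasFDerivAt_id z)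
  have h4 := ((hg.differentiable (by simp) ((t : ℝ), z)).hasFDerivAt).comp z h3
  have h5 : fderiv ℝ (g t) z = _ := h4.fderiv
  rw [h5]
  simp [g', b, A, gc]

/-- For small values of the parameter `y`, the curves `γ' = L(γ) y` issued from points near `p`
exist on `[0, 1]`, and they depend smoothly on the initial point and on `y`. At `y = 0` the
linearisation of the integral equation with respect to `γ` is the identity, so that the inverse
function theorem in the Banach space `C([0, 1], Z)` applies. -/
theorem exists_parametric_flow {Y Z : Type u} [NormedAddCommGroup Y] [NormedSpace ℝ Y]
    [CompleteSpace Y] [NormedAddCommGroup Z] [NormedSpace ℝ Z] [CompleteSpace Z]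
    {L : Z → Y →L[ℝ] Z} (hL : ContDiff ℝ ∞ L) (p : Z) :
    ∃ (Γ : Z × Y → C(unitInterval, Z)) (U : Set (Z × Y)), IsOpen U ∧ (p, 0) ∈ U ∧
      ContDiffOn ℝ ∞ Γ U ∧
      ∀ a ∈ U, Γ a = ContinuousLinearMap.const (R := ℝ) (M := Z) unitInterval a.1 +
        ContinuousMap.primitiveCLM Z (ContinuousMap.pointwiseCLM unitInterval Y Z
          ((⟨L, hL.continuous⟩ : C(Z, Y →L[ℝ] Z)).comp (Γ a))
          (ContinuousLinearMap.const (R := ℝ) (M := Y) unitInterval a.2)) ∧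
        (a.2 = 0 → Γ a = ContinuousLinearMap.const (R := ℝ) (M := Z) unitInterval a.1) := by
  let Lc : C(Z, Y →L[ℝ] Z) := ⟨L, hL.continuous⟩
  let N : (Z × Y) × C(unitInterval, Z) → C(unitInterval, Y) →L[ℝ] C(unitInterval, Z) :=
    fun u ↦ ContinuousMap.pointwiseCLM unitInterval Y Z (Lc.comp u.2)
  have hN : ContDiff ℝ ∞ N := (ContinuousLinearMap.contDiff _).comp
    ((ContinuousMap.contDiff_infty_comp_left Lc hL).comp contDiff_snd)
  let cY := ContinuousLinearMap.const (R := ℝ) (M := Y) unitInterval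
  let cZ := ContinuousLinearMap.const (R := ℝ) (M := Z) unitInterval
  let P := ContinuousMap.primitiveCLM Z
  -- the solutions are the preimages of the points `((z, y), 0)` under `H`
  let H : (Z × Y) × C(unitInterval, Z) → (Z × Y) × C(unitInterval, Z) :=
    fun u ↦ (u.1, u.2 - cZ u.1.1 - P (N u (cY u.1.2)))
  have hH : ContDiff ℝ ∞ H := by
    refine contDiff_fst.prodMk ((contDiff_snd.sub ?_).sub ?_)
    · exact cZ.contDiff.comp (contDiff_fst.comp contDiff_fst)
    · exact P.contDiff.comp (hN.clm_apply (cY.contDiff.comp (contDiff_snd.comp contDiff_fst)))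
  let u₀ : (Z × Y) × C(unitInterval, Z) := ((p, 0), cZ p)
  let B : Z × Y →L[ℝ] C(unitInterval, Z) :=
    -(cZ ∘L .fst ℝ Z Y) - P ∘L N u₀ ∘L cY ∘L .snd ℝ Z Y
  let D : ((Z × Y) × C(unitInterval, Z)) ≃L[ℝ] (Z × Y) × C(unitInterval, Z) :=
    ContinuousLinearEquiv.skewProd (.refl ℝ _) (.refl ℝ _) B
  have hD : HasFDerivAt H (D : _ →L[ℝ] _) u₀ := by
    have h1 : HasFDerivAt (fun u : (Z × Y) × C(unitInterval, Z) ↦ cY u.1.2)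
        (cY ∘L .snd ℝ Z Y ∘L .fst ℝ (Z × Y) _) u₀ :=
      (cY ∘L .snd ℝ Z Y ∘L .fst ℝ (Z × Y) C(unitInterval, Z)).hasFDerivAt
    have h2 := ((hN.differentiable (by simp)) u₀).hasFDerivAt.clm_apply h1
    have h3 : HasFDerivAt (fun u : (Z × Y) × C(unitInterval, Z) ↦ cZ u.1.1)
        (cZ ∘L .fst ℝ Z Y ∘L .fst ℝ (Z × Y) _) u₀ :=
      (cZ ∘L .fst ℝ Z Y ∘L .fst ℝ (Z × Y) C(unitInterval, Z)).hasFDerivAt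
    have h4 := (hasFDerivAt_fst (𝕜 := ℝ) (p := u₀)).prodMk
      (((hasFDerivAt_snd (𝕜 := ℝ) (p := u₀)).sub h3).sub (P.hasFDerivAt.comp u₀ h2))
    refine h4.congr_fderiv ?_
    ext x <;> simp [D, B, u₀, sub_eq_add_neg]
  obtain ⟨e, he0, -, heH, hes, -⟩ := hH.contDiffOn.exists_openPartialHomeomorph isOpen_univ
    (Set.mem_univ u₀) hD
  have hcs : Continuous (fun a : Z × Y ↦ (a, (0 : C(unitInterval, Z)))) := by fun_prop
  have hcq : Continuous (fun a : Z × Y ↦ (a, cZ a.1)) := by fun_prop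
  have hHq : ∀ a : Z × Y, a.2 = 0 → H (a, cZ a.1) = (a, 0) := by
    rintro ⟨z, y⟩ (rfl : y = 0)
    simp [H]
  -- the second condition identifies the solution for `y = 0` with the constant curve
  refine ⟨fun a ↦ (e.symm (a, 0)).2,
    (fun a ↦ (a, 0)) ⁻¹' e.target ∩ (fun a ↦ (a, cZ a.1)) ⁻¹' e.source,
    (e.open_target.preimage hcs).inter (e.open_source.preimage hcq), ⟨?_, he0⟩, ?_, ?_⟩
  · have := e.map_source he0
    rw [heH] at this
    rwa [hHq (p, 0) rfl] at this
  · exact contDiff_snd.comp_contDiffOn (hes.comp (by fun_prop) fun a ha ↦ ha.1)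
  · intro a ha
    have h1 := e.right_inv ha.1
    rw [heH] at h1
    have h2 : (e.symm (a, 0)).1 = a := congrArg Prod.fst h1
    have h3 := congrArg Prod.snd h1
    simp only [H, N, h2] at h3
    rw [sub_sub, sub_eq_zero] at h3
    refine ⟨h3, fun h0 ↦ ?_⟩
    have h4 := e.left_inv ha.2
    rw [heH, hHq a h0] at h4
    exact congrArg Prod.snd h4

end Primitive

/-! ### Straightening a commuting frame -/

/-- A smooth function on a neighbourhood of `p` has the same germ at `p` as a smooth function on
the whole space. -/
theorem ContDiffOn.exists_contDiff_eventuallyEq {E F : Type*} [NormedAddCommGroup E]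
    [NormedSpace ℝ E] [FiniteDimensional ℝ E] [NormedAddCommGroup F] [NormedSpace ℝ F]
    {f : E → F} {W : Set E} (hW : IsOpen W) (hf : ContDiffOn ℝ ∞ f W) {p : E} (hp : p ∈ W) :
    ∃ g : E → F, ContDiff ℝ ∞ g ∧ g =ᶠ[𝓝 p] f := by
  obtain ⟨ε, hε, hεW⟩ := Metric.nhds_basis_closedBall.mem_iff.1 (hW.mem_nhds hp)
  let χ : ContDiffBump p := ⟨ε / 2, ε, half_pos hε, half_lt_self hε⟩
  refine ⟨fun z ↦ χ z • f z, contDiff_iff_contDiffAt.2 fun z ↦ ?_, ?_⟩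
  · by_cases hz : z ∈ W
    · exact χ.contDiff.contDiffAt.smul (hf.contDiffAt (hW.mem_nhds hz))
    · have hzs : z ∉ tsupport χ := fun h ↦ hz (hεW (by rwa [χ.tsupport_eq] at h))
      have h0 : (fun z ↦ χ z • f z) =ᶠ[𝓝 z] fun _ ↦ 0 := by
        filter_upwards [notMem_tsupport_iff_eventuallyEq.1 hzs] with w hw
        simp [hw]
      exact contDiffAt_const.congr_of_eventuallyEq h0
  · filter_upwards [χ.eventuallyEq_one] with z hz
    simp [hz]

open MeasureTheory in
theorem ContinuousMap.hasDerivAt_integral_IccExtend {E : Type*} [NormedAddCommGroup E]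
    [NormedSpace ℝ E] [CompleteSpace E] (h : C(unitInterval, E)) (t : ℝ) :
    HasDerivAt (fun t ↦ ∫ s in (0 : ℝ)..t, Set.IccExtend zero_le_one h s)
      (Set.IccExtend zero_le_one h t) t := by
  have hc : Continuous (Set.IccExtend zero_le_one h : ℝ → E) := h.continuous.Icc_extend'
  exact intervalIntegral.integral_hasDerivAt_right (hc.intervalIntegrable _ _)
    (hc.stronglyMeasurableAtFilter _ _) hc.continuousAt

/-- The variational equation along a curve `γ' = L(γ) y`: when the vector fields `L(·) y` commute,
the variation `w` of the solution in the direction `η` of the parameter equals `t • L(γ(t)) η`.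
The difference of the two sides solves a homogeneous linear equation. -/
theorem variation_eq_of_commute {Y Z : Type*} [NormedAddCommGroup Y] [NormedSpace ℝ Y]
    [NormedAddCommGroup Z] [NormedSpace ℝ Z] [CompleteSpace Z]
    {L : Z → Y →L[ℝ] Z} (hL : ContDiff ℝ ∞ L) {y η : Y} {z₀ : Z} {γ w : C(unitInterval, Z)}
    (hcomm : ∀ t, fderiv ℝ L (γ t) (L (γ t) η) y = fderiv ℝ L (γ t) (L (γ t) y) η)
    {h₀ h₁ : C(unitInterval, Z)} (hγ : ∀ t, γ t = z₀ + ContinuousMap.primitiveCLM Z h₀ t)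
    (hh₀ : ∀ t, h₀ t = L (γ t) y) (hw : w = ContinuousMap.primitiveCLM Z h₁)
    (hh₁ : ∀ t, h₁ t = fderiv ℝ L (γ t) (w t) y + L (γ t) η) : w 1 = L (γ 1) η := by
  -- `g` and `v` are extensions of `γ` and `w` to the real line
  set g : ℝ → Z := fun t ↦ z₀ + ∫ s in (0 : ℝ)..t, Set.IccExtend zero_le_one h₀ s
  set v : ℝ → Z := fun t ↦ ∫ s in (0 : ℝ)..t, Set.IccExtend zero_le_one h₁ s
  have hg : ∀ t, HasDerivAt g (Set.IccExtend zero_le_one h₀ t) t := fun t ↦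
    (h₀.hasDerivAt_integral_IccExtend t).const_add z₀
  have hv : ∀ t, HasDerivAt v (Set.IccExtend zero_le_one h₁ t) t := fun t ↦
    h₁.hasDerivAt_integral_IccExtend t
  have hgγ : ∀ t : unitInterval, g t = γ t := fun t ↦ (hγ t).symm
  have hvw : ∀ t : unitInterval, v t = w t := fun t ↦ by rw [hw]; rfl
  have hLg : ∀ t, HasDerivAt (fun t ↦ L (g t) η)
      (fderiv ℝ L (g t) (Set.IccExtend zero_le_one h₀ t) η) t := fun t ↦ by
    have h1 := ((hL.differentiable (by simp) (g t)).hasFDerivAt).comp_hasDerivAt t (hg t)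
    simpa using h1.clm_apply (hasDerivAt_const t η)
  have hE : ∀ t, HasDerivAt (fun t ↦ v t - t • L (g t) η)
      (Set.IccExtend zero_le_one h₁ t - (t • fderiv ℝ L (g t) (Set.IccExtend zero_le_one h₀ t) η
        + (1 : ℝ) • L (g t) η)) t := fun t ↦
    (hv t).sub ((hasDerivAt_id t).smul (hLg t))
  have hgc : Continuous g := continuous_iff_continuousAt.2 fun t ↦ (hg t).continuousAt
  obtain ⟨C, hC⟩ := (isCompact_Icc (a := (0 : ℝ)) (b := 1)).exists_bound_of_continuousOn
    (((hL.continuous_fderiv (by simp)).comp hgc).continuousOn)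
  have key := eq_zero_of_abs_deriv_le_mul_abs_self_of_eq_zero_right
    (f := fun t ↦ v t - t • L (g t) η) (K := C * ‖y‖) (a := 0) (b := 1)
    (fun t _ ↦ (hE t).continuousAt.continuousWithinAt) (fun t _ ↦ (hE t).hasDerivWithinAt)
    (by simp [v]) (fun t ht ↦ ?_) 1 (by simp)
  · have h1 : v 1 = w 1 := hvw 1
    have h2 : g 1 = γ 1 := hgγ 1
    simpa [h1, h2, sub_eq_zero] using key
  · lift t to unitInterval using ⟨ht.1, ht.2.le⟩
    have : Set.IccExtend zero_le_one h₁ (t : ℝ) -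
        ((t : ℝ) • fderiv ℝ L (g t) (Set.IccExtend zero_le_one h₀ (t : ℝ)) η
          + (1 : ℝ) • L (g t) η) = fderiv ℝ L (g t) (v t - (t : ℝ) • L (g t) η) y := by
      rw [Set.IccExtend_val, Set.IccExtend_val, hgγ, hvw, hh₀, hh₁, map_sub, map_smul,
        _root_.sub_apply, _root_.smul_apply, hcomm, one_smul]
      abel
    rw [this]
    calc _ ≤ ‖fderiv ℝ L (g t)‖ * ‖v t - (t : ℝ) • L (g t) η‖ * ‖y‖ :=
          ContinuousLinearMap.le_opNorm₂ _ _ _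
      _ ≤ C * ‖v t - (t : ℝ) • L (g t) η‖ * ‖y‖ := by
          gcongr
          exact hC t t.2
      _ = _ := by ring

/-- **Frobenius theorem** for a commuting frame. If the vector fields `L(·) y` commute near `p` and
`Z = ι S ⊕ L(p) Y`, then there are coordinates `Φ : S × Y → Z` near `p` in which `L(·) y` is the
constant field `(0, y)`: the point `Φ(s, y)` is reached from `p + ι s` by following the flow of
`L(·) y` up to time `1`. -/
theorem exists_coordinates_of_commuting_frame {S Y Z : Type u} [NormedAddCommGroup S]
    [NormedSpace ℝ S] [NormedAddCommGroup Y] [NormedSpace ℝ Y]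
    [CompleteSpace Y] [NormedAddCommGroup Z] [NormedSpace ℝ Z] [CompleteSpace Z]
    {L : Z → Y →L[ℝ] Z} (hL : ContDiff ℝ ∞ L) {p : Z} {W : Set Z} (hW : IsOpen W) (hp : p ∈ W)
    (hcomm : ∀ z ∈ W, ∀ y η, fderiv ℝ L z (L z η) y = fderiv ℝ L z (L z y) η)
    (ι : S →L[ℝ] Z) (e : (S × Y) ≃L[ℝ] Z) (he : ∀ s y, e (s, y) = ι s + L p y) :
    ∃ (Φ : S × Y → Z) (U : Set (S × Y)), IsOpen U ∧ 0 ∈ U ∧ Φ 0 = p ∧ ContDiffOn ℝ ∞ Φ U ∧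
      HasFDerivAt Φ (e : S × Y →L[ℝ] Z) 0 ∧
      ∀ u ∈ U, ∀ η, fderiv ℝ Φ u (0, η) = L (Φ u) η := by
  obtain ⟨Γ, U₀, hU₀, hpU, hΓ, hΓU⟩ := exists_parametric_flow hL p
  -- the fields commute only on `W`: keep the parameters whose curves stay there
  let O : Set C(unitInterval, Z) := {γ | Set.MapsTo γ Set.univ W}
  have hO : IsOpen O := ContinuousMap.isOpen_setOfPred_mapsTo isCompact_univ hW
  let U₁ : Set (Z × Y) := U₀ ∩ Γ ⁻¹' O
  have hU₁ : IsOpen U₁ := hΓ.continuousOn.isOpen_inter_preimage hU₀ hO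
  have hpU₁ : (p, 0) ∈ U₁ := by
    refine ⟨hpU, ?_⟩
    have := (hΓU _ hpU).2 rfl
    intro t _
    rw [this]
    exact hp
  have key : ∀ a ∈ U₁, ∀ η : Y, fderiv ℝ Γ a (0, η) 1 = L (Γ a 1) η := by
    intro a ha η
    -- the right-hand side of the equation, as a function of the pair `(γ(t), y)`
    have hX : ContDiff ℝ ∞ (fun x : Z × Y ↦ L x.1 x.2) :=
      (hL.comp contDiff_fst).clm_apply contDiff_snd
    let X : C(Z × Y, Z) := ⟨fun x ↦ L x.1 x.2, hX.continuous⟩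
    let X' : C(Z × Y, Z × Y →L[ℝ] Z) := ⟨fderiv ℝ X, hX.continuous_fderiv (by simp)⟩
    have hX' : ∀ (x : Z × Y) (z : Z) (y : Y), X' x (z, y) = fderiv ℝ L x.1 z x.2 + L x.1 y := by
      intro x z y
      have h1 : HasFDerivAt (fun x : Z × Y ↦ L x.1) (fderiv ℝ L x.1 ∘L .fst ℝ Z Y) x :=
        ((hL.differentiable (by simp) x.1).hasFDerivAt).comp x hasFDerivAt_fst
      have h2 : fderiv ℝ X x = _ := (h1.clm_apply hasFDerivAt_snd).fderiv
      change fderiv ℝ X x (z, y) = _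
      rw [h2]
      simp [add_comm]
    let J : C(unitInterval, Z) →L[ℝ] C(unitInterval, Z × Y) :=
      (ContinuousLinearMap.inl ℝ Z Y).compLeftContinuous ℝ unitInterval
    let c : Y →L[ℝ] C(unitInterval, Z × Y) :=
      ContinuousLinearMap.const (R := ℝ) (M := Z × Y) unitInterval ∘L .inr ℝ Z Y
    have hd : HasFDerivAt Γ (fderiv ℝ Γ a) a :=
      ((hΓ.contDiffAt (hU₀.mem_nhds ha.1)).differentiableAt (by simp)).hasFDerivAt
    have h1 : HasFDerivAt (fun a : Z × Y ↦ J (Γ a) + c a.2)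
        (J ∘L fderiv ℝ Γ a + c ∘L .snd ℝ Z Y) a :=
      (J.hasFDerivAt.comp a hd).add (c ∘L .snd ℝ Z Y).hasFDerivAt
    have h2 := (ContinuousMap.hasFDerivAt_comp_left X X'
      (fun x ↦ (hX.differentiable (by simp) x).hasFDerivAt) (J (Γ a) + c a.2)).comp a h1
    have h4 := (ContinuousMap.primitiveCLM Z).hasFDerivAt.comp a h2
    have h5 : HasFDerivAt (fun a : Z × Y ↦
        ContinuousLinearMap.const (R := ℝ) (M := Z) unitInterval a.1) _ a :=
      (ContinuousLinearMap.const (R := ℝ) (M := Z) unitInterval ∘L .fst ℝ Z Y).hasFDerivAt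
    have hXΓ : ∀ b : Z × Y, X.comp (J (Γ b) + c b.2) =
        ContinuousMap.pointwiseCLM unitInterval Y Z
          ((⟨L, hL.continuous⟩ : C(Z, Y →L[ℝ] Z)).comp (Γ b))
          (ContinuousLinearMap.const (R := ℝ) (M := Y) unitInterval b.2) := by
      intro b
      ext t
      simp [X, J, c]
    have h6 := hd.unique ((h5.add h4).congr_of_eventuallyEq
      (Filter.mem_of_superset (hU₀.mem_nhds ha.1) fun b hb ↦ by
        refine (hΓU b hb).1.trans ?_
        rw [← hXΓ]
        rfl))
    have h7 := congrArg (fun A ↦ A (0, η)) h6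
    refine variation_eq_of_commute hL (y := a.2) (z₀ := a.1) (γ := Γ a)
      (w := fderiv ℝ Γ a (0, η)) (h₀ := X.comp (J (Γ a) + c a.2))
      (h₁ := ContinuousMap.pointwiseCLM unitInterval (Z × Y) Z (X'.comp (J (Γ a) + c a.2))
        (J (fderiv ℝ Γ a (0, η)) + c η))
      (fun t ↦ hcomm _ (ha.2 (Set.mem_univ t)) _ _) (fun t ↦ ?_) (fun t ↦ ?_) ?_ (fun t ↦ ?_)
    · rw [hXΓ]
      exact congrArg (fun γ : C(unitInterval, Z) ↦ γ t) (hΓU a ha.1).1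
    · simp [X, J, c]
    · simpa using h7
    · have : (J (fderiv ℝ Γ a (0, η)) + c η) t = (fderiv ℝ Γ a (0, η) t, η) := by simp [J, c]
      rw [ContinuousMap.pointwiseCLM_apply, this, ContinuousMap.comp_apply, hX']
      simp [J, c]
  -- the initial points run through the transversal `p + ι S`
  let A : S × Y → Z × Y := fun u ↦ (p + ι u.1, u.2)
  have hA : ContDiff ℝ ∞ A := by fun_prop
  have hA' : ∀ u, HasFDerivAt A ((ι ∘L .fst ℝ S Y).prod (.snd ℝ S Y)) u := fun u ↦
    ((ι ∘L .fst ℝ S Y).hasFDerivAt.const_add p).prodMk hasFDerivAt_snd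
  have hA0 : A 0 = (p, 0) := by simp [A]
  let ev : C(unitInterval, Z) →L[ℝ] Z := ContinuousMap.evalCLM ℝ 1
  have hΦ : ∀ u ∈ A ⁻¹' U₁, HasFDerivAt (fun u ↦ ev (Γ (A u)))
      (ev ∘L fderiv ℝ Γ (A u) ∘L (ι ∘L .fst ℝ S Y).prod (.snd ℝ S Y)) u := by
    intro u hu
    have hd : HasFDerivAt Γ (fderiv ℝ Γ (A u)) (A u) :=
      ((hΓ.contDiffAt (hU₀.mem_nhds hu.1)).differentiableAt (by simp)).hasFDerivAt
    exact ev.hasFDerivAt.comp u (hd.comp u (hA' u))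
  have hU : IsOpen (A ⁻¹' U₁) := hU₁.preimage hA.continuous
  have h0U : (0 : S × Y) ∈ A ⁻¹' U₁ := by rwa [Set.mem_preimage, hA0]
  have hvert : ∀ u ∈ A ⁻¹' U₁, ∀ η, fderiv ℝ (fun u ↦ ev (Γ (A u))) u (0, η) =
      L (ev (Γ (A u))) η := by
    intro u hu η
    rw [(hΦ u hu).fderiv]
    simpa [ev] using key _ hu η
  have hhor : ∀ u ∈ A ⁻¹' U₁, u.2 = 0 → ev (Γ (A u)) = p + ι u.1 := by
    intro u hu h0
    rw [(hΓU _ hu.1).2 h0]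
    rfl
  have hΦ0 : ev (Γ (A 0)) = p := by simpa using hhor 0 h0U rfl
  refine ⟨fun u ↦ ev (Γ (A u)), A ⁻¹' U₁, hU, h0U, hΦ0,
    ev.contDiff.comp_contDiffOn (hΓ.comp hA.contDiffOn fun u hu ↦ hu.1), ?_, hvert⟩
  have hd := (hΦ 0 h0U).differentiableAt.hasFDerivAt
  refine hd.congr_fderiv (ContinuousLinearMap.ext fun ⟨s, y⟩ ↦ ?_)
  have hs : fderiv ℝ (fun u ↦ ev (Γ (A u))) 0 (s, 0) = ι s := by
    have hi : HasFDerivAt (fun s : S ↦ (s, (0 : Y))) (.inl ℝ S Y) 0 :=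
      (ContinuousLinearMap.inl ℝ S Y).hasFDerivAt
    have h1 := HasFDerivAt.comp (f := fun s : S ↦ (s, (0 : Y))) 0 hd hi
    have h2 : HasFDerivAt (fun s ↦ p + ι s) ι 0 := ι.hasFDerivAt.const_add p
    have hc : ContinuousAt (fun s : S ↦ (s, (0 : Y))) 0 := by fun_prop
    have h3 := h1.unique (h2.congr_of_eventuallyEq
      (Filter.mem_of_superset (hc.preimage_mem_nhds (hU.mem_nhds h0U))
        fun s hs ↦ hhor (s, 0) hs rfl))
    simpa using congrArg (fun B ↦ B s) h3
  have hsum : ((s, y) : S × Y) = (s, 0) + (0, y) := by simp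
  rw [hsum, map_add, hs, hvert 0 h0U, hΦ0, ← hsum]
  exact (he s y).symm

/-! ### Smooth distributions with integral manifolds -/

/-- The vector fields `L(·) y` of a frame `L` of `V`, normalised by `π (L(z) y) = y` for a fixed
linear map `π`, commute at every point `z` through which an integral manifold `f` of `V` passes:
differentiate `Df = L(f) ∘ π ∘ Df` and use the symmetry of the second derivative of `f`. -/
theorem commute_of_integral_manifold {R Y Z : Type*} [NormedAddCommGroup R] [NormedSpace ℝ R]
    [NormedAddCommGroup Y] [NormedSpace ℝ Y] [NormedAddCommGroup Z] [NormedSpace ℝ Z]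
    {L : Z → Y →L[ℝ] Z} {z : Z} (hL : DifferentiableAt ℝ L z) (π : Z →L[ℝ] Y)
    (hπ : ∀ᶠ z' in 𝓝 z, ∀ y, π (L z' y) = y) {V : Z → Submodule ℝ Z}
    (hV : ∀ᶠ z' in 𝓝 z, LinearMap.range (L z' : Y →ₗ[ℝ] Z) = V z')
    {f : R → Z} (hf : ContDiffAt ℝ 2 f 0) (hf0 : f 0 = z)
    (hfV : ∀ᶠ u in 𝓝 0, LinearMap.range (fderiv ℝ f u : R →ₗ[ℝ] Z) = V (f u)) (y η : Y) :
    fderiv ℝ L z (L z η) y = fderiv ℝ L z (L z y) η := by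
  subst hf0
  have hfd : HasFDerivAt f (fderiv ℝ f 0) 0 := (hf.differentiableAt (by simp)).hasFDerivAt
  have hf2 : HasFDerivAt (fderiv ℝ f) (fderiv ℝ (fderiv ℝ f) 0) 0 :=
    ((hf.fderiv_right (m := 1) (by norm_num)).differentiableAt (by simp)).hasFDerivAt
  have hcont : Filter.Tendsto f (𝓝 0) (𝓝 (f 0)) := hf.continuousAt
  have hrel : ∀ v : R, (fun u ↦ fderiv ℝ f u v) =ᶠ[𝓝 0] fun u ↦ L (f u) (π (fderiv ℝ f u v)) := by
    intro v
    filter_upwards [hfV, hcont.eventually hπ, hcont.eventually hV] with u h1 h2 h3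
    have h4 : fderiv ℝ f u v ∈ V (f u) := by rw [← h1]; exact ⟨v, rfl⟩
    rw [← h3] at h4
    obtain ⟨y, hy⟩ := h4
    have hy' : L (f u) y = fderiv ℝ f u v := hy
    rw [← hy', h2]
  have hD : ∀ a v : R, fderiv ℝ (fderiv ℝ f) 0 a v =
      fderiv ℝ L (f 0) (fderiv ℝ f 0 a) (π (fderiv ℝ f 0 v)) +
        L (f 0) (π (fderiv ℝ (fderiv ℝ f) 0 a v)) := by
    intro a v
    have h1 : HasFDerivAt (fun u ↦ fderiv ℝ f u v) _ 0 := hf2.clm_apply (hasFDerivAt_const v 0)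
    have h2 : HasFDerivAt (fun u ↦ L (f u)) _ 0 := hL.hasFDerivAt.comp 0 hfd
    have h3 := h1.unique
      ((h2.clm_apply (π.hasFDerivAt.comp 0 h1)).congr_of_eventuallyEq (hrel v))
    have h4 := congrArg (fun A ↦ A a) h3
    simpa [add_comm] using h4
  have hsymm : ∀ a v : R, fderiv ℝ L (f 0) (fderiv ℝ f 0 a) (π (fderiv ℝ f 0 v)) =
      fderiv ℝ L (f 0) (fderiv ℝ f 0 v) (π (fderiv ℝ f 0 a)) := by
    intro a v
    have h1 : fderiv ℝ (fderiv ℝ f) 0 a v = fderiv ℝ (fderiv ℝ f) 0 v a :=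
      (hf.isSymmSndFDerivAt (by simp)).eq a v
    have h2 := hD v a
    rw [← h1] at h2
    exact add_right_cancel ((hD a v).symm.trans h2)
  have hπ0 := hπ.self_of_nhds
  have hex : ∀ y : Y, ∃ a, fderiv ℝ f 0 a = L (f 0) y := by
    intro y
    have : L (f 0) y ∈ LinearMap.range (fderiv ℝ f 0 : R →ₗ[ℝ] Z) := by
      rw [hfV.self_of_nhds, ← hV.self_of_nhds]
      exact ⟨y, rfl⟩
    exact this
  obtain ⟨a, ha⟩ := hex η
  obtain ⟨v, hv⟩ := hex y
  have := hsymm a v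
  rwa [ha, hv, hπ0, hπ0] at this

/-- A smooth distribution of constant rank has, near `p`, a smooth frame normalised by a linear
projection onto its fibre `V p`; if integral manifolds pass through all points, the frame
commutes. -/
theorem exists_commuting_frame {Z : Type u} [NormedAddCommGroup Z] [NormedSpace ℝ Z]
    [FiniteDimensional ℝ Z] {W : Set Z} (hW : IsOpen W) {p : Z} (hp : p ∈ W)
    {V : Z → Submodule ℝ Z} {l r : ℕ} {X : Fin l → Z → Z} (hX : ∀ j, ContDiffOn ℝ ∞ (X j) W)
    (hV : ∀ z ∈ W, V z = Submodule.span ℝ (Set.range fun j ↦ X j z))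
    (hr : ∀ z ∈ W, Module.finrank ℝ (V z) = r)
    {R : Type*} [NormedAddCommGroup R] [NormedSpace ℝ R]
    (hint : ∀ z ∈ W, ∃ f : R → Z, ContDiffAt ℝ 2 f 0 ∧ f 0 = z ∧
      ∀ᶠ u in 𝓝 0, LinearMap.range (fderiv ℝ f u : R →ₗ[ℝ] Z) = V (f u)) :
    ∃ (L : Z → V p →L[ℝ] Z) (W' : Set Z), ContDiff ℝ ∞ L ∧ (∀ y, L p y = y) ∧
      IsOpen W' ∧ p ∈ W' ∧ W' ⊆ W ∧
      (∀ z ∈ W', LinearMap.range (L z : V p →ₗ[ℝ] Z) = V z) ∧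
      ∀ z ∈ W', ∀ y η, fderiv ℝ L z (L z η) y = fderiv ℝ L z (L z y) η := by
  obtain ⟨π, hπ⟩ := Submodule.ClosedComplemented.of_finiteDimensional_quotient
    (Submodule.closed_of_finiteDimensional (V p))
  -- `T z` is the parametrisation of `V z` by the spanning fields, which may be linearly dependent
  let T : Z → (Fin l → ℝ) →L[ℝ] Z := fun z ↦
    ∑ j, (ContinuousLinearMap.proj (R := ℝ) (φ := fun _ : Fin l ↦ ℝ) j).smulRight (X j z)
  have hTa : ∀ z c, T z c = ∑ j, c j • X j z := fun z c ↦ by simp [T]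
  have hT : ContDiffOn ℝ ∞ T W := ContDiffOn.sum fun j _ ↦
    (ContinuousLinearMap.contDiff (ContinuousLinearMap.smulRightL ℝ (Fin l → ℝ) Z
      (ContinuousLinearMap.proj (R := ℝ) (φ := fun _ : Fin l ↦ ℝ) j))).comp_contDiffOn (hX j)
  have hTV : ∀ z ∈ W, LinearMap.range (T z : (Fin l → ℝ) →ₗ[ℝ] Z) = V z := by
    intro z hz
    ext w
    rw [hV z hz, Submodule.mem_span_range_iff_exists_fun]
    simp [hTa]
  -- a linear right inverse of `T p` onto its range
  obtain ⟨C, hC⟩ : ∃ C : V p →L[ℝ] (Fin l → ℝ), ∀ y, T p (C y) = y := by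
    have hmem : ∀ c, T p c ∈ V p := fun c ↦ by rw [← hTV p hp]; exact ⟨c, rfl⟩
    obtain ⟨C, hC⟩ := LinearMap.exists_rightInverse_of_surjective
      ((T p : (Fin l → ℝ) →ₗ[ℝ] Z).codRestrict (V p) hmem) (by
        rw [LinearMap.range_eq_top]
        rintro ⟨y, hy⟩
        rw [← hTV p hp] at hy
        obtain ⟨c, hc⟩ := hy
        exact ⟨c, Subtype.ext hc⟩)
    refine ⟨LinearMap.toContinuousLinearMap C, fun y ↦ ?_⟩
    exact congrArg Subtype.val (LinearMap.congr_fun hC y)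
  -- `B z` maps `V p` into `V z`, and it is the inclusion at `z = p`; the frame is `B` normalised by
  -- the inverse of `π ∘ B z`
  let B : Z → V p →L[ℝ] Z := fun z ↦ T z ∘L C
  let M : Z → V p →L[ℝ] V p := fun z ↦ π ∘L B z
  have hB : ContDiffOn ℝ ∞ B W := hT.clm_comp contDiffOn_const
  have hM : ContDiffOn ℝ ∞ M W := contDiffOn_const.clm_comp hB
  have hMp : M p = 1 := by
    ext y
    simp [M, B, hC, hπ]
  let W₀ : Set Z := W ∩ M ⁻¹' {A | IsUnit A}
  have hunits : IsOpen {A : V p →L[ℝ] V p | IsUnit A} := Units.isOpen (R := V p →L[ℝ] V p)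
  have hW₀ : IsOpen W₀ := hM.continuousOn.isOpen_inter_preimage hW hunits
  have hpW₀ : p ∈ W₀ := ⟨hp, by simp [hMp]⟩
  let L₀ : Z → V p →L[ℝ] Z := fun z ↦ B z ∘L Ring.inverse (M z)
  have hL₀ : ContDiffOn ℝ ∞ L₀ W₀ := by
    refine (hB.mono Set.inter_subset_left).clm_comp fun z hz ↦ ?_
    obtain ⟨A, hA⟩ := hz.2
    have h1 : ContDiffAt ℝ ∞ Ring.inverse (M z) := by
      rw [← hA]
      exact contDiffAt_ringInverse (R := V p →L[ℝ] V p) ℝ A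
    exact (h1.comp z (hM.contDiffAt (hW.mem_nhds hz.1))).contDiffWithinAt
  obtain ⟨L, hL, hLe⟩ := hL₀.exists_contDiff_eventuallyEq hW₀ hpW₀
  obtain ⟨W₁, hW₁, hW₁o, hpW₁⟩ := eventually_nhds_iff.1 hLe
  have hπL : ∀ z ∈ W₀ ∩ W₁, ∀ y, π (L z y) = y := by
    rintro z ⟨hz, hz1⟩ y
    rw [hW₁ z hz1]
    have h1 : M z * Ring.inverse (M z) = 1 := Ring.mul_inverse_cancel _ hz.2
    exact congrArg (fun A ↦ A y) h1
  have hLV : ∀ z ∈ W₀ ∩ W₁, LinearMap.range (L z : V p →ₗ[ℝ] Z) = V z := by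
    rintro z ⟨hz, hz1⟩
    apply Submodule.eq_of_le_of_finrank_eq
    · rintro _ ⟨y, rfl⟩
      rw [← hTV z hz.1]
      refine ⟨C (Ring.inverse (M z) y), ?_⟩
      simp [hW₁ z hz1, L₀, B]
    · rw [LinearMap.finrank_range_of_inj, hr p hp, hr z hz.1]
      exact Function.LeftInverse.injective (g := π) (hπL z ⟨hz, hz1⟩)
  have hO : IsOpen (W₀ ∩ W₁) := hW₀.inter hW₁o
  refine ⟨L, W₀ ∩ W₁, hL, fun y ↦ ?_, hO, ⟨hpW₀, hpW₁⟩, fun z hz ↦ hz.1.1, hLV,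
    fun z hz y η ↦ ?_⟩
  · rw [hW₁ p hpW₁]
    simp [L₀, B, hMp, hC]
  · obtain ⟨f, hf, hf0, hfV⟩ := hint z hz.1.1
    exact commute_of_integral_manifold (hL.differentiable (by simp) z) π
      (Filter.mem_of_superset (hO.mem_nhds hz) hπL) (Filter.mem_of_superset (hO.mem_nhds hz) hLV)
      hf hf0 hfV y η

/-! ### The relative Poincaré lemma -/

/-- A field of bilinear forms on a normed space is a closed two-form at `z`: it is alternating at
`z`, and its exterior derivative at `z` vanishes. -/
def IsClosedTwoFormAt {E : Type*} [NormedAddCommGroup E] [NormedSpace ℝ E]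
    (b : E → E →L[ℝ] E →L[ℝ] ℝ) (z : E) : Prop :=
  (∀ u v, b z u v = -b z v u) ∧
    ∀ a u v, fderiv ℝ b z a u v - fderiv ℝ b z u a v + fderiv ℝ b z v a u = 0

open MeasureTheory in
/-- The homotopy formula for the linear homotopy `A + t B`, `0 ≤ t ≤ 1`: the pullbacks of a closed
two-form under `A + B` and under `A` differ by an exact form. -/
theorem exists_primitive_of_linear_homotopy {E : Type u} [NormedAddCommGroup E] [NormedSpace ℝ E]
    {b : E → E →L[ℝ] E →L[ℝ] ℝ} (hb : ContDiff ℝ ∞ b) (A B : E →L[ℝ] E) :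
    ∃ θ : E → E →L[ℝ] ℝ, ContDiff ℝ ∞ θ ∧
      (∀ z w, θ z w = ∫ t in (0 : ℝ)..1, b (A z + t • B z) (B z) (A w + t • B w)) ∧
      ∀ z, (∀ t ∈ Set.Icc (0 : ℝ) 1, IsClosedTwoFormAt b (A z + t • B z)) →
        ∀ u v, fderiv ℝ θ z u v - fderiv ℝ θ z v u =
          b (A z + B z) (A u + B u) (A v + B v) - b (A z) (A u) (A v) := by
  let g : ℝ → E → E →L[ℝ] ℝ := fun t z ↦ b (A z + t • B z) (B z) ∘L (A + t • B)
  have hg : ContDiff ℝ ∞ (fun x : ℝ × E ↦ g x.1 x.2) := by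
    have h1 : ContDiff ℝ ∞ (fun x : ℝ × E ↦ A x.2 + x.1 • B x.2) := by fun_prop
    have h2 : ContDiff ℝ ∞ (fun x : ℝ × E ↦ b (A x.2 + x.1 • B x.2) (B x.2)) :=
      (hb.comp h1).clm_apply (by fun_prop)
    exact h2.clm_comp (by fun_prop)
  have hgd : ∀ t z, HasFDerivAt (g t)
      (((ContinuousLinearMap.compL ℝ E E ℝ).flip (A + t • B)) ∘L
        ((b (A z + t • B z)) ∘L B +
          (fderiv ℝ b (A z + t • B z) ∘L (A + t • B)).flip (B z))) z := by
    intro t z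
    have h1 : HasFDerivAt (fun z ↦ A z + t • B z) (A + t • B) z :=
      A.hasFDerivAt.add (B.hasFDerivAt.const_smul t)
    have h2 : HasFDerivAt (fun z ↦ b (A z + t • B z))
        (fderiv ℝ b (A z + t • B z) ∘L (A + t • B)) z :=
      HasFDerivAt.comp (g := b) (f := fun z ↦ A z + t • B z) z
        (hb.differentiable (by simp) (A z + t • B z)).hasFDerivAt h1
    exact ((ContinuousLinearMap.compL ℝ E E ℝ).flip (A + t • B)).hasFDerivAt.comp z
      (h2.clm_apply B.hasFDerivAt)
  obtain ⟨hθ, hθd⟩ := contDiff_integral_unitInterval hg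
  have hgc : ∀ z, Continuous fun t ↦ g t z := fun z ↦
    hg.continuous.comp (by fun_prop : Continuous fun t : ℝ ↦ (t, z))
  have hdc : ∀ z u, Continuous fun t ↦ fderiv ℝ (g t) z u := by
    intro z u
    have h1 : ∀ t, fderiv ℝ (g t) z =
        fderiv ℝ (fun x : ℝ × E ↦ g x.1 x.2) (t, z) ∘L .inr ℝ ℝ E := by
      intro t
      exact (((hg.differentiable (by simp) (t, z)).hasFDerivAt).comp z
        ((hasFDerivAt_const t z).prodMk (hasFDerivAt_id z))).fderiv
    simp only [h1]
    have h2 := hg.continuous_fderiv (by simp)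
    have h3 : Continuous fun t : ℝ ↦ fderiv ℝ (fun x : ℝ × E ↦ g x.1 x.2) (t, z) :=
      h2.comp (by fun_prop : Continuous fun t : ℝ ↦ (t, z))
    exact h3.clm_apply continuous_const
  refine ⟨fun z ↦ ∫ t in (0 : ℝ)..1, g t z, hθ, fun z w ↦ ?_, fun z hz u v ↦ ?_⟩
  · rw [ContinuousLinearMap.intervalIntegral_apply ((hgc z).intervalIntegrable _ _)]
    simp [g]
  rw [hθd, hθd, ContinuousLinearMap.intervalIntegral_apply ((hdc z u).intervalIntegrable _ _),
    ContinuousLinearMap.intervalIntegral_apply ((hdc z v).intervalIntegrable _ _),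
    ← intervalIntegral.integral_sub (((hdc z u).clm_apply continuous_const).intervalIntegrable _ _)
      (((hdc z v).clm_apply continuous_const).intervalIntegrable _ _)]
  -- by closedness, the integrand is the derivative of the pullback of `b` under `A + t B`
  have hF : ∀ t : ℝ, HasDerivAt (fun t : ℝ ↦ b (A z + t • B z) (A u + t • B u) (A v + t • B v))
      (fderiv ℝ b (A z + t • B z) (B z) (A u + t • B u) (A v + t • B v) +
        b (A z + t • B z) (B u) (A v + t • B v) + b (A z + t • B z) (A u + t • B u) (B v)) t := by
    intro t
    have hl : ∀ w, HasDerivAt (fun t : ℝ ↦ A w + t • B w) (B w) t := by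
      intro w
      simpa using ((hasDerivAt_id t).smul_const (B w)).const_add (A w)
    have h1 := ((hb.differentiable (by simp) (A z + t • B z)).hasFDerivAt).comp_hasDerivAt t (hl z)
    have h2 := (h1.clm_apply (hl u)).clm_apply (hl v)
    simpa using h2
  have hFTC := intervalIntegral.integral_eq_sub_of_hasDerivAt (a := 0) (b := 1)
    (fun t _ ↦ hF t) (by
      refine Continuous.intervalIntegrable ?_ _ _
      have h0 : Continuous b := hb.continuous
      have h1 := hb.continuous_fderiv (by simp)
      fun_prop)
  simp only [one_smul, zero_smul, add_zero] at hFTC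
  rw [← hFTC]
  refine intervalIntegral.integral_congr fun t ht ↦ ?_
  rw [Set.uIcc_of_le zero_le_one] at ht
  obtain ⟨h1, h2⟩ := hz t ht
  have h3 := h2 (B z) (A u + t • B u) (A v + t • B v)
  have h4 := h1 (A u + t • B u) (B v)
  simp only [(hgd t z).fderiv]
  simp only [ContinuousLinearMap.comp_apply, ContinuousLinearMap.flip_apply,
    ContinuousLinearMap.compL_apply, _root_.add_apply, _root_.smul_apply, map_add, map_smul,
    smul_eq_mul] at h3 h4 ⊢
  linarith

/-- **Relative Poincaré lemma.** A closed two-form on a ball of `S × Y` that vanishes on pairs of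
vectors tangent to the fibres `{s} × Y` has a primitive that vanishes on these vectors. The ball is
first contracted to `S × {0}` along the fibres, and then to the origin. -/
theorem exists_primitive_of_isotropic_fibres {S Y : Type u} [NormedAddCommGroup S]
    [NormedSpace ℝ S] [NormedAddCommGroup Y] [NormedSpace ℝ Y]
    {b : S × Y → S × Y →L[ℝ] S × Y →L[ℝ] ℝ} (hb : ContDiff ℝ ∞ b) {ε : ℝ}
    (hclosed : ∀ z ∈ Metric.ball (0 : S × Y) ε, IsClosedTwoFormAt b z)
    (hiso : ∀ z ∈ Metric.ball (0 : S × Y) ε, ∀ y η, b z (0, y) (0, η) = 0) :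
    ∃ θ : S × Y → S × Y →L[ℝ] ℝ, ContDiff ℝ ∞ θ ∧ ∀ z ∈ Metric.ball (0 : S × Y) ε,
      (∀ η, θ z (0, η) = 0) ∧ ∀ u v, fderiv ℝ θ z u v - fderiv ℝ θ z v u = b z u v := by
  let P : S × Y →L[ℝ] S × Y := .inl ℝ S Y ∘L .fst ℝ S Y
  let Q : S × Y →L[ℝ] S × Y := .inr ℝ S Y ∘L .snd ℝ S Y
  obtain ⟨θ₁, hθ₁, hθ₁a, hθ₁d⟩ := exists_primitive_of_linear_homotopy hb P Q
  obtain ⟨θ₂, hθ₂, hθ₂a, hθ₂d⟩ := exists_primitive_of_linear_homotopy hb 0 P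
  have hball₁ : ∀ z ∈ Metric.ball (0 : S × Y) ε, ∀ t ∈ Set.Icc (0 : ℝ) 1,
      P z + t • Q z ∈ Metric.ball (0 : S × Y) ε := by
    rintro ⟨s, y⟩ hz t ht
    rw [mem_ball_zero_iff] at hz ⊢
    refine lt_of_le_of_lt ?_ hz
    simp only [P, Q, ContinuousLinearMap.comp_apply, ContinuousLinearMap.coe_fst',
      ContinuousLinearMap.coe_snd', ContinuousLinearMap.inl_apply, ContinuousLinearMap.inr_apply,
      Prod.smul_mk, smul_zero, Prod.mk_add_mk, add_zero, zero_add, Prod.norm_mk]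
    refine max_le_max le_rfl ?_
    rw [norm_smul, Real.norm_of_nonneg ht.1]
    exact mul_le_of_le_one_left (norm_nonneg y) ht.2
  have hball₂ : ∀ z ∈ Metric.ball (0 : S × Y) ε, ∀ t ∈ Set.Icc (0 : ℝ) 1,
      (0 : S × Y →L[ℝ] S × Y) z + t • P z ∈ Metric.ball (0 : S × Y) ε := by
    rintro ⟨s, y⟩ hz t ht
    rw [mem_ball_zero_iff] at hz ⊢
    refine lt_of_le_of_lt ?_ hz
    simp only [P, ContinuousLinearMap.comp_apply, ContinuousLinearMap.coe_fst',
      ContinuousLinearMap.inl_apply, Prod.smul_mk, smul_zero, _root_.zero_apply, zero_add,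
      Prod.norm_mk, norm_zero]
    refine max_le_max ?_ (norm_nonneg y)
    rw [norm_smul, Real.norm_of_nonneg ht.1]
    exact mul_le_of_le_one_left (norm_nonneg s) ht.2
  refine ⟨θ₁ + θ₂, hθ₁.add hθ₂, fun z hz ↦ ⟨fun η ↦ ?_, fun u v ↦ ?_⟩⟩
  · have h1 : θ₁ z (0, η) = 0 := by
      rw [hθ₁a]
      refine intervalIntegral.integral_zero_ae (Filter.Eventually.of_forall fun t ht ↦ ?_)
      rw [Set.uIoc_of_le zero_le_one] at ht
      have := hiso _ (hball₁ z hz t ⟨ht.1.le, ht.2⟩) z.2 (t • η)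
      simpa [P, Q] using this
    have h2 : θ₂ z (0, η) = 0 := by
      rw [hθ₂a]
      simp [P, Prod.mk_zero_zero]
    simp [h1, h2]
  · have h1 := hθ₁d z (fun t ht ↦ hclosed _ (hball₁ z hz t ht)) u v
    have h2 := hθ₂d z (fun t ht ↦ hclosed _ (hball₂ z hz t ht)) u v
    have hPQ : ∀ w, P w + Q w = w := fun w ↦ by simp [P, Q]
    simp only [hPQ] at h1
    simp only [_root_.zero_apply, map_zero, zero_add, sub_zero] at h2
    rw [fderiv_add (hθ₁.differentiable (by simp) z) (hθ₂.differentiable (by simp) z)]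
    simp only [_root_.add_apply]
    linarith

/-! ### Darboux coordinates in a vector space -/

/-- The pullback of a field of bilinear forms under `Φ`. -/
noncomputable def pullbackForm {E Z : Type*} [NormedAddCommGroup E] [NormedSpace ℝ E]
    [NormedAddCommGroup Z] [NormedSpace ℝ Z] (b : Z → Z →L[ℝ] Z →L[ℝ] ℝ) (Φ : E → Z) (x : E) :
    E →L[ℝ] E →L[ℝ] ℝ :=
  (ContinuousLinearMap.compL ℝ E Z ℝ).flip (fderiv ℝ Φ x) ∘L b (Φ x) ∘L fderiv ℝ Φ x

section

variable {E Z : Type*} [NormedAddCommGroup E] [NormedSpace ℝ E]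
    [NormedAddCommGroup Z] [NormedSpace ℝ Z] {b : Z → Z →L[ℝ] Z →L[ℝ] ℝ} {Φ : E → Z}

@[simp]
theorem pullbackForm_apply (x u v : E) :
    pullbackForm b Φ x u v = b (Φ x) (fderiv ℝ Φ x u) (fderiv ℝ Φ x v) := rfl

theorem ContDiffOn.pullbackForm {U : Set E} {W : Set Z} (hU : IsOpen U)
    (hb : ContDiffOn ℝ ∞ b W) (hΦ : ContDiffOn ℝ ∞ Φ U) (hUW : Set.MapsTo Φ U W) :
    ContDiffOn ℝ ∞ (pullbackForm b Φ) U := by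
  have h1 : ContDiffOn ℝ ∞ (fderiv ℝ Φ) U := hΦ.fderiv_of_isOpen hU (by simp)
  exact ((ContinuousLinearMap.contDiff (ContinuousLinearMap.compL ℝ E Z ℝ).flip).comp_contDiffOn
    h1).clm_comp ((hb.comp hΦ hUW).clm_comp h1)

/-- Pullbacks of closed two-forms are closed: the terms with second derivatives of `Φ` cancel by
symmetry. -/
theorem IsClosedTwoFormAt.pullbackForm {x : E} (hb : IsClosedTwoFormAt b (Φ x))
    (hbd : DifferentiableAt ℝ b (Φ x)) (hΦ : ContDiffAt ℝ 2 Φ x) :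
    IsClosedTwoFormAt (pullbackForm b Φ) x := by
  refine ⟨fun u v ↦ hb.1 _ _, fun a u v ↦ ?_⟩
  have hΦ1 : HasFDerivAt Φ (fderiv ℝ Φ x) x := (hΦ.differentiableAt (by simp)).hasFDerivAt
  have hΦ2 : HasFDerivAt (fderiv ℝ Φ) (fderiv ℝ (fderiv ℝ Φ) x) x :=
    ((hΦ.fderiv_right (m := 1) (by norm_num)).differentiableAt (by simp)).hasFDerivAt
  have hbΦ : HasFDerivAt (fun x ↦ b (Φ x)) (fderiv ℝ b (Φ x) ∘L fderiv ℝ Φ x) x :=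
    HasFDerivAt.comp (g := b) (f := Φ) x hbd.hasFDerivAt hΦ1
  have hcomp : HasFDerivAt (fun x ↦ (ContinuousLinearMap.compL ℝ E Z ℝ).flip (fderiv ℝ Φ x))
      ((ContinuousLinearMap.compL ℝ E Z ℝ).flip ∘L fderiv ℝ (fderiv ℝ Φ) x) x :=
    HasFDerivAt.comp (g := (ContinuousLinearMap.compL ℝ E Z ℝ).flip) (f := fderiv ℝ Φ) x
      (ContinuousLinearMap.hasFDerivAt _) hΦ2
  have h1 := hcomp.clm_comp (hbΦ.clm_comp hΦ2)
  have h2 : fderiv ℝ (_root_.pullbackForm b Φ) x = _ := h1.fderiv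
  have key : ∀ a u v, fderiv ℝ (_root_.pullbackForm b Φ) x a u v =
      fderiv ℝ b (Φ x) (fderiv ℝ Φ x a) (fderiv ℝ Φ x u) (fderiv ℝ Φ x v) +
      b (Φ x) (fderiv ℝ (fderiv ℝ Φ) x a u) (fderiv ℝ Φ x v) +
      b (Φ x) (fderiv ℝ Φ x u) (fderiv ℝ (fderiv ℝ Φ) x a v) := by
    intro a u v
    rw [h2]
    simp
    ring
  have hs : ∀ a u, fderiv ℝ (fderiv ℝ Φ) x a u = fderiv ℝ (fderiv ℝ Φ) x u a := fun a u ↦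
    (hΦ.isSymmSndFDerivAt (by simp)).eq a u
  rw [key, key, key, hs u a, hs v a, hs v u]
  have h3 := hb.2 (fderiv ℝ Φ x a) (fderiv ℝ Φ x u) (fderiv ℝ Φ x v)
  have h4 := hb.1 (fderiv ℝ (fderiv ℝ Φ) x a v) (fderiv ℝ Φ x u)
  have h5 := hb.1 (fderiv ℝ (fderiv ℝ Φ) x u v) (fderiv ℝ Φ x a)
  have h6 := hb.1 (fderiv ℝ (fderiv ℝ Φ) x a u) (fderiv ℝ Φ x v)
  linarith

theorem IsClosedTwoFormAt.congr {b c : E → E →L[ℝ] E →L[ℝ] ℝ} {x : E}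
    (hb : IsClosedTwoFormAt b x) (h : c =ᶠ[𝓝 x] b) : IsClosedTwoFormAt c x := by
  unfold IsClosedTwoFormAt
  rw [h.fderiv_eq, h.self_of_nhds]
  exact hb

end

/-- A subspace `V₀` of codimension `n` is the second factor of a linear splitting `ℝⁿ × V₀ ≃ Z`. -/
theorem exists_splitting {Z : Type*} [NormedAddCommGroup Z] [NormedSpace ℝ Z]
    [FiniteDimensional ℝ Z] (V₀ : Submodule ℝ Z) {n : ℕ}
    (hn : Module.finrank ℝ Z = n + Module.finrank ℝ V₀) :
    ∃ (ι : (Fin n → ℝ) →L[ℝ] Z) (e : ((Fin n → ℝ) × V₀) ≃L[ℝ] Z), ∀ s y, e (s, y) = ι s + y := by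
  obtain ⟨S, hS⟩ := V₀.exists_isCompl
  have hdim : Module.finrank ℝ (Fin n → ℝ) = Module.finrank ℝ S := by
    have := Submodule.finrank_add_eq_of_isCompl hS
    rw [Module.finrank_fin_fun]
    omega
  let j : (Fin n → ℝ) ≃ₗ[ℝ] S := LinearEquiv.ofFinrankEq _ _ hdim
  let e : ((Fin n → ℝ) × V₀) ≃ₗ[ℝ] Z :=
    (j.prodCongr (.refl ℝ V₀)).trans (Submodule.prodEquivOfIsCompl S V₀ hS.symm)
  refine ⟨LinearMap.toContinuousLinearMap (S.subtype ∘ₗ j.toLinearMap),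
    e.toContinuousLinearEquiv, fun s y ↦ ?_⟩
  simp [e]

/-- **Darboux coordinates in adapted coordinates.** Suppose closed two-forms `c α` on a
ball of `ℝⁿ × Y` vanish on pairs of vectors tangent to the fibres `{s} × Y`, and have no common
kernel at the origin. Then relative primitives `-∑ᵢ p^α_i dq^i` of the `c α` provide the
coordinates `p^α_i`. -/
theorem exists_darboux_coordinates_of_fibres {n k : ℕ} {Y : Type} [NormedAddCommGroup Y]
    [NormedSpace ℝ Y] [FiniteDimensional ℝ Y] (hY : Module.finrank ℝ Y = n * k)
    {c : Fin k → (Fin n → ℝ) × Y → (Fin n → ℝ) × Y →L[ℝ] (Fin n → ℝ) × Y →L[ℝ] ℝ}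
    (hc : ∀ α, ContDiff ℝ ∞ (c α)) {ε : ℝ} (hε : 0 < ε)
    (hclosed : ∀ α, ∀ z ∈ Metric.ball (0 : (Fin n → ℝ) × Y) ε, IsClosedTwoFormAt (c α) z)
    (hiso : ∀ α, ∀ z ∈ Metric.ball (0 : (Fin n → ℝ) × Y) ε, ∀ y η, c α z (0, y) (0, η) = 0)
    (hker : ∀ u, (∀ α v, c α 0 u v = 0) → u = 0) :
    ∃ Ψ : OpenPartialHomeomorph ((Fin n → ℝ) × Y) (DarbouxSpace n k),
      0 ∈ Ψ.source ∧ Ψ.source ⊆ Metric.ball 0 ε ∧ ContDiffOn ℝ ∞ Ψ Ψ.source ∧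
      ContDiffOn ℝ ∞ Ψ.symm Ψ.target ∧ ∀ z ∈ Ψ.source,
        (∀ u, (fderiv ℝ Ψ z u).1 = u.1) ∧
        ∀ α u v, c α z u v = ∑ i, ((fderiv ℝ Ψ z u).1 i * (fderiv ℝ Ψ z v).2 α i -
          (fderiv ℝ Ψ z v).1 i * (fderiv ℝ Ψ z u).2 α i) := by
  choose θ hθ hθ0 using fun α ↦ exists_primitive_of_isotropic_fibres (hc α) (hclosed α) (hiso α)
  let ev : Fin n → ((Fin n → ℝ) × Y →L[ℝ] ℝ) →L[ℝ] ℝ := fun i ↦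
    ContinuousLinearMap.apply ℝ ℝ (Pi.single i 1, 0)
  let F : (Fin n → ℝ) × Y → DarbouxSpace n k := fun z ↦ (z.1, fun α i ↦ -ev i (θ α z))
  have hF : ContDiff ℝ ∞ F := contDiff_fst.prodMk <| contDiff_pi.2 fun α ↦ contDiff_pi.2 fun i ↦
    ((ev i).contDiff.comp (hθ α)).neg
  have hF' : ∀ z, HasFDerivAt F ((ContinuousLinearMap.fst ℝ (Fin n → ℝ) Y).prod
      (ContinuousLinearMap.pi fun α ↦ ContinuousLinearMap.pi fun i ↦ -(ev i ∘L fderiv ℝ (θ α) z)))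
      z := fun z ↦ by
    refine hasFDerivAt_fst.prodMk (hasFDerivAt_pi.2 fun α ↦ hasFDerivAt_pi.2 fun i ↦ ?_)
    exact ((ev i).hasFDerivAt.comp z ((hθ α).differentiable (by simp) z).hasFDerivAt).neg
  have hF1 : ∀ z u, (fderiv ℝ F z u).1 = u.1 := fun z u ↦ by rw [(hF' z).fderiv]; rfl
  have hF2 : ∀ z u α i, (fderiv ℝ F z u).2 α i = -fderiv ℝ (θ α) z u (Pi.single i 1, 0) :=
    fun z u α i ↦ by rw [(hF' z).fderiv]; rfl
  -- the derivatives of `θ α` also vanish on the fibre directions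
  have hθv : ∀ α, ∀ z ∈ Metric.ball (0 : (Fin n → ℝ) × Y) ε, ∀ u η,
      fderiv ℝ (θ α) z u (0, η) = 0 := by
    intro α z hz u η
    have h1 : HasFDerivAt (fun z ↦ θ α z (0, η)) _ z :=
      ((hθ α).differentiable (by simp) z).hasFDerivAt.clm_apply (hasFDerivAt_const (0, η) z)
    have h2 := h1.unique ((hasFDerivAt_const (0 : ℝ) z).congr_of_eventuallyEq
      (Filter.mem_of_superset (Metric.isOpen_ball.mem_nhds hz) fun w hw ↦ (hθ0 α w hw).1 η))
    simpa using congrArg (fun A ↦ A u) h2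
  have hθs : ∀ α, ∀ z ∈ Metric.ball (0 : (Fin n → ℝ) × Y) ε, ∀ u v : (Fin n → ℝ) × Y,
      fderiv ℝ (θ α) z u v = ∑ i, v.1 i * fderiv ℝ (θ α) z u (Pi.single i 1, 0) := by
    rintro α z hz u ⟨s, y⟩
    have h1 : ((s, y) : (Fin n → ℝ) × Y) = ∑ i, s i • (Pi.single i 1, 0) + (0, y) := by
      ext
      · simp [Prod.fst_sum, Finset.sum_apply, Pi.single_apply]
      · simp [Prod.snd_sum]
    conv_lhs => rw [h1]
    rw [map_add, hθv α z hz, add_zero, map_sum]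
    exact Finset.sum_congr rfl fun i _ ↦ by rw [map_smul, smul_eq_mul]
  have hform : ∀ z ∈ Metric.ball (0 : (Fin n → ℝ) × Y) ε, ∀ α u v,
      c α z u v = ∑ i, ((fderiv ℝ F z u).1 i * (fderiv ℝ F z v).2 α i -
          (fderiv ℝ F z v).1 i * (fderiv ℝ F z u).2 α i) := by
    intro z hz α u v
    rw [← (hθ0 α z hz).2 u v, hθs α z hz u v, hθs α z hz v u, ← Finset.sum_sub_distrib]
    refine Finset.sum_congr rfl fun i _ ↦ ?_
    rw [hF1, hF1, hF2, hF2]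
    ring
  have h0 : (0 : (Fin n → ℝ) × Y) ∈ Metric.ball 0 ε := Metric.mem_ball_self hε
  have hinj : Function.Injective (fderiv ℝ F 0) := by
    rw [injective_iff_map_eq_zero]
    intro u hu
    refine hker u fun α v ↦ ?_
    rw [hform 0 h0, hu]
    simp
  -- the derivative of `F` at the origin is injective, and the dimensions agree
  have hdim : Module.finrank ℝ ((Fin n → ℝ) × Y) = Module.finrank ℝ (DarbouxSpace n k) := by
    simp [hY, Module.finrank_pi_fintype, mul_comm]
  let D : ((Fin n → ℝ) × Y) ≃L[ℝ] DarbouxSpace n k :=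
    (LinearEquiv.ofInjectiveOfFinrankEq (fderiv ℝ F 0 : _ →ₗ[ℝ] DarbouxSpace n k) hinj
      hdim).toContinuousLinearEquiv
  have hD : HasFDerivAt F (D : (Fin n → ℝ) × Y →L[ℝ] DarbouxSpace n k) 0 :=
    (hF.differentiable (by simp) 0).hasFDerivAt
  obtain ⟨Ψ, hΨ0, hΨε, hΨF, hΨs, -⟩ := hF.contDiffOn.exists_openPartialHomeomorph
    Metric.isOpen_ball h0 hD
  refine ⟨Ψ, hΨ0, hΨε, by rw [hΨF]; exact hF.contDiffOn, hΨs, fun z hz ↦ ?_⟩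
  rw [hΨF]
  exact ⟨hF1 z, hform z (hΨε hz)⟩

/-- The Darboux theorem for `k`-symplectic structures on an open set of a vector space. -/
theorem exists_darboux_coordinates {n k : ℕ} {Z : Type} [NormedAddCommGroup Z] [NormedSpace ℝ Z]
    [FiniteDimensional ℝ Z] (hZ : Module.finrank ℝ Z = n * (k + 1)) {W : Set Z} (hW : IsOpen W)
    {p : Z} (hp : p ∈ W) {b : Fin k → Z → Z →L[ℝ] Z →L[ℝ] ℝ}
    (hb : ∀ α, ContDiffOn ℝ ∞ (b α) W) (hclosed : ∀ α, ∀ z ∈ W, IsClosedTwoFormAt (b α) z)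
    {V : Z → Submodule ℝ Z} {l : ℕ} {X : Fin l → Z → Z} (hX : ∀ j, ContDiffOn ℝ ∞ (X j) W)
    (hV : ∀ z ∈ W, V z = Submodule.span ℝ (Set.range fun j ↦ X j z))
    (hr : ∀ z ∈ W, Module.finrank ℝ (V z) = n * k)
    {R : Type*} [NormedAddCommGroup R] [NormedSpace ℝ R]
    (hint : ∀ z ∈ W, ∃ f : R → Z, ContDiffAt ℝ 2 f 0 ∧ f 0 = z ∧
      ∀ᶠ u in 𝓝 0, LinearMap.range (fderiv ℝ f u : R →ₗ[ℝ] Z) = V (f u))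
    (hiso : ∀ α, ∀ z ∈ W, ∀ v ∈ V z, ∀ w ∈ V z, b α z v w = 0)
    (hker : ∀ z ∈ W, ∀ v, (∀ α w, b α z v w = 0) → v = 0) :
    ∃ ψ : OpenPartialHomeomorph Z (DarbouxSpace n k), p ∈ ψ.source ∧ ψ.source ⊆ W ∧
      ContDiffOn ℝ ∞ ψ ψ.source ∧ ContDiffOn ℝ ∞ ψ.symm ψ.target ∧ ∀ z ∈ ψ.source,
        (∀ α u v, b α z u v = ∑ i, ((fderiv ℝ ψ z u).1 i * (fderiv ℝ ψ z v).2 α i -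
          (fderiv ℝ ψ z v).1 i * (fderiv ℝ ψ z u).2 α i)) ∧
        ∀ v, v ∈ V z ↔ (fderiv ℝ ψ z v).1 = 0 := by
  obtain ⟨L, W', hL, hLp, hW', hpW', hW'W, hLV, hcomm⟩ :=
    exists_commuting_frame hW hp hX hV hr hint
  obtain ⟨ι, e, he⟩ := exists_splitting (n := n) (V p) (by rw [hZ, hr p hp]; ring)
  obtain ⟨Φ, U, hU, h0U, hΦ0, hΦ, hΦe, hΦL⟩ := exists_coordinates_of_commuting_frame hL hW' hpW'
    hcomm ι e (fun s y ↦ by rw [he, hLp])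
  have hU' : IsOpen (U ∩ Φ ⁻¹' W') := hΦ.continuousOn.isOpen_inter_preimage hU hW'
  obtain ⟨Φe, hΦe0, hΦeU, hΦeΦ, hΦes, hΦeD⟩ :=
    (hΦ.mono Set.inter_subset_left).exists_openPartialHomeomorph hU' (a := 0)
      ⟨h0U, by rwa [Set.mem_preimage, hΦ0]⟩ hΦe
  have hΦo : ContDiffOn ℝ ∞ Φ Φe.source := hΦ.mono fun x hx ↦ (hΦeU hx).1
  have hΦW : Set.MapsTo Φ Φe.source W := fun x hx ↦ hW'W (hΦeU hx).2
  have hΦat : ∀ x ∈ Φe.source, ContDiffAt ℝ ∞ Φ x := fun x hx ↦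
    hΦo.contDiffAt (Φe.open_source.mem_nhds hx)
  -- `c α` is a smooth form on the whole space with the germ of the pullback of `b α` at the origin
  choose c hc hce using fun α ↦ (((hb α).pullbackForm Φe.open_source hΦo
    hΦW).exists_contDiff_eventuallyEq Φe.open_source hΦe0)
  obtain ⟨ε, hε, hball⟩ := Metric.eventually_nhds_iff_ball.1
    ((Filter.eventually_all.2 hce).and (Φe.open_source.mem_nhds hΦe0))
  have hcb : ∀ α, ∀ x ∈ Metric.ball 0 ε, ∀ u v,
      c α x u v = b α (Φ x) (fderiv ℝ Φ x u) (fderiv ℝ Φ x v) := by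
    intro α x hx u v
    rw [(hball x hx).1 α]
    rfl
  obtain ⟨Ψ, hΨ0, hΨε, hΨ, hΨs, hΨform⟩ := exists_darboux_coordinates_of_fibres (hr p hp) hc hε
    (fun α x hx ↦ by
      have hx' := (hball x hx).2
      refine IsClosedTwoFormAt.congr (IsClosedTwoFormAt.pullbackForm (hclosed α _ (hΦW hx'))
        (((hb α).contDiffAt (hW.mem_nhds (hΦW hx'))).differentiableAt (by simp))
        ((hΦat x hx').of_le
          (show ((2 : ℕ∞) : WithTop ℕ∞) ≤ _ from WithTop.coe_le_coe.2 le_top))) ?_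
      exact Filter.mem_of_superset (Metric.isOpen_ball.mem_nhds hx) fun w hw ↦ (hball w hw).1 α)
    (fun α x hx y η ↦ by
      have hx' := hΦeU (hball x hx).2
      have hmem : ∀ y, fderiv ℝ Φ x (0, y) ∈ V (Φ x) := fun y ↦ by
        rw [hΦL x hx'.1, ← hLV _ hx'.2]
        exact ⟨y, rfl⟩
      rw [hcb α x hx]
      exact hiso α _ (hW'W hx'.2) _ (hmem y) _ (hmem η))
    (fun u hu ↦ by
      have h0 : (0 : (Fin n → ℝ) × V p) ∈ Metric.ball 0 ε := Metric.mem_ball_self hε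
      refine e.injective ?_
      rw [map_zero]
      refine hker p hp _ fun α w ↦ ?_
      have := hu α (e.symm w)
      rw [hcb α 0 h0, hΦe.fderiv, hΦ0] at this
      simpa using this)
  refine ⟨Φe.symm.trans Ψ, ?_, ?_, ?_, ?_, ?_⟩
  · rw [OpenPartialHomeomorph.trans_source]
    have h1 : Φe 0 = p := by rw [hΦeΦ, hΦ0]
    have h2 := Φe.map_source hΦe0
    have h3 := Φe.left_inv hΦe0
    rw [h1] at h2 h3
    refine ⟨h2, ?_⟩
    rw [Set.mem_preimage, h3]
    exact hΨ0
  · intro z hz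
    have h1 := Φe.map_target hz.1
    have h2 := hΦW h1
    rwa [← hΦeΦ, Φe.right_inv hz.1] at h2
  · exact hΨ.comp (hΦes.mono fun z hz ↦ hz.1) fun z hz ↦ hz.2
  · refine ContDiffOn.comp (t := Φe.source) (by
        change ContDiffOn ℝ ∞ Φe Φe.source
        rw [hΦeΦ]
        exact hΦo)
     
      (hΨs.mono fun z hz ↦ hz.1) fun z hz ↦ hz.2
  · intro z hz
    obtain ⟨x, hx, rfl⟩ : ∃ x, x ∈ Φe.source ∧ Φe x = z :=
      ⟨Φe.symm z, Φe.map_target hz.1, Φe.right_inv hz.1⟩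
    have hxΨ : x ∈ Ψ.source := by
      have : Φe.symm (Φe x) ∈ Ψ.source := hz.2
      rwa [Φe.left_inv hx] at this
    have hxε := hΨε hxΨ
    obtain ⟨g, hg⟩ := hΦeD x hx
    have hgs : HasFDerivAt Φe.symm (g.symm : Z →L[ℝ] _) (Φe x) := by
      refine Φe.hasFDerivAt_symm hz.1 ?_
      rw [Φe.left_inv hx, hΦeΦ]
      exact hg
    have hΨd : HasFDerivAt Ψ (fderiv ℝ Ψ x) (Φe.symm (Φe x)) := by
      rw [Φe.left_inv hx]
      exact ((hΨ.contDiffAt (Ψ.open_source.mem_nhds hxΨ)).differentiableAt (by simp)).hasFDerivAt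
    have hψ : fderiv ℝ (Φe.symm.trans Ψ) (Φe x) = fderiv ℝ Ψ x ∘L (g.symm : Z →L[ℝ] _) :=
      (hΨd.comp (Φe x) hgs).fderiv
    rw [hψ]
    obtain ⟨h1, h2⟩ := hΨform x hxΨ
    refine ⟨fun α u v ↦ ?_, fun v ↦ ?_⟩
    · have h3 := h2 α (g.symm u) (g.symm v)
      rw [hcb α x hxε, hg.fderiv] at h3
      simpa [hΦeΦ] using h3
    · have hx' := hΦeU hx
      rw [ContinuousLinearMap.comp_apply, ContinuousLinearEquiv.coe_coe, h1, hΦeΦ, ← hLV _ hx'.2]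
      have hgL : ∀ η, g (0, η) = L (Φ x) η := fun η ↦ by
        rw [← hΦL x hx'.1, hg.fderiv]
        rfl
      constructor
      · rintro ⟨η, rfl⟩
        change (g.symm (L (Φ x) η)).1 = 0
        rw [← hgL, g.symm_apply_apply]
      · intro h0
        refine ⟨(g.symm v).2, ?_⟩
        change L (Φ x) (g.symm v).2 = v
        rw [← hgL, ← h0, Prod.mk.eta, g.apply_symm_apply]

/-! ### Transfer to manifolds -/

section

variable {E : Type*} [NormedAddCommGroup E] [NormedSpace ℝ E]

theorem ContinuousAlternatingMap.apply_vecCons_swap (η : E [⋀^Fin 2]→L[ℝ] ℝ) (u v : E) :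
    η ![u, v] = -η ![v, u] := by
  have h := η.toAlternatingMap.map_swap ![v, u] (i := 0) (j := 1) (by decide)
  have hvu : ![v, u] ∘ Equiv.swap (0 : Fin 2) 1 = ![u, v] := by
    ext i
    fin_cases i <;> simp
  rw [hvu] at h
  exact h

/-- The bilinear form `(u, v) ↦ η ![u, v]` of an alternating two-form. -/
noncomputable def ContinuousAlternatingMap.toBilin (η : E [⋀^Fin 2]→L[ℝ] ℝ) :
    E →L[ℝ] E →L[ℝ] ℝ :=
  LinearMap.mkContinuous₂
    (LinearMap.mk₂ ℝ (fun u v ↦ η ![u, v])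
      (fun u u' v ↦ η.cons_add ![v] u u') (fun c u v ↦ η.cons_smul ![v] c u)
      (fun u v v' ↦ by
        rw [η.apply_vecCons_swap, η.apply_vecCons_swap u v, η.apply_vecCons_swap u v']
        have := η.cons_add ![u] v v'
        simp only [Matrix.vecCons] at this ⊢
        rw [this]
        ring)
      (fun c u v ↦ by
        rw [η.apply_vecCons_swap, η.apply_vecCons_swap u v]
        have := η.cons_smul ![u] c v
        simp only [Matrix.vecCons] at this ⊢
        rw [this, smul_neg])) ‖η‖ (fun u v ↦ by
      have := η.le_opNorm ![u, v]
      rw [Fin.prod_univ_two, ← mul_assoc] at this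
      exact this)

theorem ContDiffOn.toBilin [FiniteDimensional ℝ E] {η : E → E [⋀^Fin 2]→L[ℝ] ℝ} {s : Set E}
    (hη : ContDiffOn ℝ ∞ η s) : ContDiffOn ℝ ∞ (fun z ↦ (η z).toBilin) s :=
  contDiffOn_clm_apply.2 fun u ↦ contDiffOn_clm_apply.2 fun v ↦
    (ContinuousAlternatingMap.apply ℝ E ℝ ![u, v]).contDiff.comp_contDiffOn hη

theorem isClosedTwoFormAt_toBilin [FiniteDimensional ℝ E] {η : E → E [⋀^Fin 2]→L[ℝ] ℝ}
    {s : Set E} (hs : IsOpen s) (hη : ContDiffOn ℝ ∞ η s) {z : E} (hz : z ∈ s)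
    (hd : extDeriv η z = 0) :
    IsClosedTwoFormAt (fun z ↦ (η z).toBilin) z := by
  refine ⟨fun u v ↦ (η z).apply_vecCons_swap u v, fun a u v ↦ ?_⟩
  have h1 := (hη.contDiffAt (hs.mem_nhds hz)).differentiableAt (by simp)
  have h2 := (hη.toBilin.contDiffAt (hs.mem_nhds hz)).differentiableAt (by simp)
  have h3 : ∀ a u v, fderiv ℝ (fun z ↦ (η z).toBilin) z a u v =
      fderiv ℝ (fun z ↦ η z ![u, v]) z a := by
    intro a u v
    have h4 : HasFDerivAt (fun z ↦ (η z).toBilin u) _ z :=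
      h2.hasFDerivAt.clm_apply (hasFDerivAt_const u z)
    have h5 : HasFDerivAt (fun z ↦ η z ![u, v]) _ z := h4.clm_apply (hasFDerivAt_const v z)
    rw [h5.fderiv]
    simp
  have h4 := extDeriv_apply h1 ![a, u, v]
  rw [hd, Fin.sum_univ_three] at h4
  have e0 : (0 : Fin 3).removeNth ![a, u, v] = ![u, v] := by ext i; fin_cases i <;> rfl
  have e1 : (1 : Fin 3).removeNth ![a, u, v] = ![a, v] := by ext i; fin_cases i <;> rfl
  have e2 : (2 : Fin 3).removeNth ![a, u, v] = ![a, u] := by ext i; fin_cases i <;> rfl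
  rw [e0, e1, e2] at h4
  rw [h3, h3, h3]
  simp at h4
  linarith

end

section

variable {m : ℕ} {M : Type*} [TopologicalSpace M] [ChartedSpace (EuclideanSpace ℝ (Fin m)) M]

/-- The expression of a distribution in a chart `e`: the image of `V` under the derivative of
`e`. -/
noncomputable def SubspaceField.inChart (V : SubspaceField m M)
    (e : OpenPartialHomeomorph M (EuclideanSpace ℝ (Fin m))) (u : EuclideanSpace ℝ (Fin m)) :
    Submodule ℝ (EuclideanSpace ℝ (Fin m)) :=
  (V (e.symm u)).map (mfderiv (𝓡 m) (𝓡 m) e (e.symm u)).toLinearMap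

theorem SubspaceField.inChart_apply (V : SubspaceField m M)
    (e : OpenPartialHomeomorph M (EuclideanSpace ℝ (Fin m))) {y : M} (hy : y ∈ e.source) :
    V.inChart e (e y) = (V y).map (mfderiv (𝓡 m) (𝓡 m) e y).toLinearMap := by
  let g : M → Submodule ℝ (EuclideanSpace ℝ (Fin m)) := fun y ↦
    (V y).map (mfderiv (𝓡 m) (𝓡 m) e y).toLinearMap
  exact congrArg g (e.left_inv hy)

theorem SubspaceField.finrank_inChart (V : SubspaceField m M)
    {e : OpenPartialHomeomorph M (EuclideanSpace ℝ (Fin m))}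
    (he : e.MDifferentiable (𝓡 m) (𝓡 m)) {u : EuclideanSpace ℝ (Fin m)} (hu : u ∈ e.target) :
    Module.finrank ℝ (V.inChart e u) = Module.finrank ℝ (V (e.symm u)) :=
  LinearEquiv.finrank_map_eq (he.mfderiv (e.map_target hu)).toLinearEquiv _

/-- The expression of a two-form in a chart, evaluated on images of tangent vectors under the
derivative of the chart, gives back the two-form. -/
theorem TwoFormField.inChart_apply (Ω : TwoFormField m M)
    {e : OpenPartialHomeomorph M (EuclideanSpace ℝ (Fin m))}
    (he : e.MDifferentiable (𝓡 m) (𝓡 m)) {y : M} (hy : y ∈ e.source)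
    (v w : TangentSpace (𝓡 m) y) :
    (Ω.inChart e (e y)).toBilin (mfderiv (𝓡 m) (𝓡 m) e y v) (mfderiv (𝓡 m) (𝓡 m) e y w) =
      Ω y ![v, w] := by
  let g : M → EuclideanSpace ℝ (Fin m) → EuclideanSpace ℝ (Fin m) → ℝ := fun y v w ↦ Ω y ![v, w]
  have h1 : ∀ v : TangentSpace (𝓡 m) y,
      mfderiv (𝓡 m) (𝓡 m) e.symm (e y) (mfderiv (𝓡 m) (𝓡 m) e y v) = v := fun v ↦
    congrArg (fun A ↦ A v) (he.symm_comp_deriv hy)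
  have h2 : (Ω.inChart e (e y)).toBilin (mfderiv (𝓡 m) (𝓡 m) e y v)
      (mfderiv (𝓡 m) (𝓡 m) e y w) = g (e.symm (e y))
        (mfderiv (𝓡 m) (𝓡 m) e.symm (e y) (mfderiv (𝓡 m) (𝓡 m) e y v))
        (mfderiv (𝓡 m) (𝓡 m) e.symm (e y) (mfderiv (𝓡 m) (𝓡 m) e y w)) := by
    change Ω (e.symm (e y)) _ = Ω (e.symm (e y)) _
    congr 1
    ext i
    fin_cases i <;> rfl
  rw [h2, e.left_inv hy]
  exact congrArg₂ (g y) (h1 v) (h1 w)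

/-- The components of a smooth vector field in a chart are smooth: the derivative of the chart is
the trivialization of the tangent bundle over its domain. -/
theorem contDiffOn_mfderiv_chartAt [IsManifold (𝓡 m) ∞ M]
    {X : (y : M) → TangentSpace (𝓡 m) y} {U : Set M} (hU : IsOpen U)
    (hX : ContMDiffOn (𝓡 m) (𝓡 m).tangent ∞
      (fun y ↦ (⟨y, X y⟩ : TangentBundle (𝓡 m) M)) U) (x : M) :
    ContDiffOn ℝ ∞ (fun u : EuclideanSpace ℝ (Fin m) ↦
      (mfderiv (𝓡 m) (𝓡 m) (chartAt (EuclideanSpace ℝ (Fin m)) x)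
        ((chartAt (EuclideanSpace ℝ (Fin m)) x).symm u)
        (X ((chartAt (EuclideanSpace ℝ (Fin m)) x).symm u)) : EuclideanSpace ℝ (Fin m)))
      ((chartAt (EuclideanSpace ℝ (Fin m)) x).target ∩
        (chartAt (EuclideanSpace ℝ (Fin m)) x).symm ⁻¹' U) := by
  set e := chartAt (EuclideanSpace ℝ (Fin m)) x with he
  let t := trivializationAt (EuclideanSpace ℝ (Fin m)) (TangentSpace (𝓡 m) : M → Type _) x
  have hb : t.baseSet = e.source := TangentBundle.trivializationAt_baseSet x
  have h1 : ContMDiffOn (𝓡 m) 𝓘(ℝ, EuclideanSpace ℝ (Fin m)) ∞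
      (fun y ↦ (t ⟨y, X y⟩).2) (U ∩ e.source) :=
    (t.contMDiffOn_section_iff (hU.inter e.open_source)
      (by rw [hb]; exact Set.inter_subset_right)).1 (hX.mono Set.inter_subset_left)
  have h2 : ContMDiffOn (𝓡 m) 𝓘(ℝ, EuclideanSpace ℝ (Fin m)) ∞
      (fun u ↦ (t ⟨e.symm u, X (e.symm u)⟩).2) (e.target ∩ e.symm ⁻¹' U) :=
    h1.comp (contMDiffOn_chart_symm.mono Set.inter_subset_left)
      fun u hu ↦ ⟨hu.2, e.map_target hu.1⟩
  refine (contMDiffOn_iff_contDiffOn.1 h2).congr fun u hu ↦ ?_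
  have hy : e.symm u ∈ e.source := e.map_target hu.1
  have h3 := TangentBundle.continuousLinearMapAt_trivializationAt (I := 𝓡 m) (x₀ := x) hy
  have h4 : t.continuousLinearMapAt ℝ (e.symm u) (X (e.symm u)) =
      (t ⟨e.symm u, X (e.symm u)⟩).2 := by
    rw [Bundle.Trivialization.continuousLinearMapAt_apply, t.linearMapAt_apply,
      if_pos (by rw [hb]; exact hy)]
  rw [← h4]
  change _ = (trivializationAt (EuclideanSpace ℝ (Fin m)) (TangentSpace (𝓡 m) : M → Type _)
    x).continuousLinearMapAt ℝ (e.symm u) _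
  rw [h3]
  rfl

end

theorem mainTheorem1 {n k : ℕ} {M : Type*} [TopologicalSpace M]
    [ChartedSpace (EuclideanSpace ℝ (Fin (n * (k + 1)))) M]
    [IsManifold (𝓡 (n * (k + 1))) ∞ M]
    (Ω : Fin k → TwoFormField (n * (k + 1)) M) (V : SubspaceField (n * (k + 1)) M)
    (h : IsKSymplectic Ω V) (x : M) :
    ∃ φ : OpenPartialHomeomorph M (DarbouxSpace n k),
      x ∈ φ.source ∧ IsCoordinateSystem (m := n * (k + 1)) φ ∧
      ∀ y ∈ φ.source,
        (∀ (α : Fin k) (v w : TangentSpace (𝓡 (n * (k + 1))) y),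
          Ω α y ![v, w] = ∑ i : Fin n, (dq φ i y v * dp φ α i y w - dq φ i y w * dp φ α i y v)) ∧
        V y = Submodule.span ℝ (Set.range fun a : Fin k × Fin n ↦ partialP φ a.1 a.2 y) := by
  obtain ⟨U, hU, hxU, l, X, hX, hXV⟩ := h.smooth_distribution x
  set e := chartAt (EuclideanSpace ℝ (Fin (n * (k + 1)))) x
  have hea : e ∈ atlas (EuclideanSpace ℝ (Fin (n * (k + 1)))) M := chart_mem_atlas _ x
  have hes : ContMDiffOn (𝓡 (n * (k + 1))) (𝓡 (n * (k + 1))) ∞ e e.source := contMDiffOn_chart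
  have het : ContMDiffOn (𝓡 (n * (k + 1))) (𝓡 (n * (k + 1))) ∞ e.symm e.target :=
    contMDiffOn_chart_symm
  have he : e.MDifferentiable (𝓡 (n * (k + 1))) (𝓡 (n * (k + 1))) :=
    ⟨hes.mdifferentiableOn (by simp), het.mdifferentiableOn (by simp)⟩
  have hxe : x ∈ e.source := mem_chart_source _ x
  set W := e.target ∩ e.symm ⁻¹' U
  have hW : IsOpen W := e.isOpen_inter_preimage_symm hU
  have hpW : e x ∈ W := ⟨e.map_source hxe, by rwa [Set.mem_preimage, e.left_inv hxe]⟩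
  -- every point of `W` is `e y` for a point `y` of the chart domain
  have hWe : ∀ z ∈ W, ∃ y, y ∈ e.source ∧ e y = z := fun z hz ↦
    ⟨e.symm z, e.map_target hz.1, e.right_inv hz.1⟩
  obtain ⟨ψ, hpψ, hψW, hψ, hψs, hψform⟩ := exists_darboux_coordinates (n := n) (k := k) (by simp)
    hW hpW (b := fun α z ↦ ((Ω α).inChart e z).toBilin)
    (fun α ↦ ((h.smooth_form α e hea).mono Set.inter_subset_left).toBilin)
    (fun α z hz ↦ isClosedTwoFormAt_toBilin e.open_target (h.smooth_form α e hea) hz.1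
      (h.closed_form α e hea z hz.1))
    (V := V.inChart e)
    (X := fun j z ↦ mfderiv (𝓡 (n * (k + 1))) (𝓡 (n * (k + 1))) e (e.symm z) (X j (e.symm z)))
    (fun j ↦ contDiffOn_mfderiv_chartAt hU (hX j) x)
    (fun z hz ↦ by
      rw [SubspaceField.inChart, hXV _ hz.2]
      refine (Submodule.map_span _ _).trans ?_
      rw [← Set.range_comp]
      rfl)
    (fun z hz ↦ (V.finrank_inChart he hz.1).trans (h.rank_distribution _))
    (R := EuclideanSpace ℝ (Fin (n * k)))
    (fun z hz ↦ by
      obtain ⟨N, f, hN, h0N, hf0, -, hf, hfV⟩ := h.integrable_distribution (e.symm z)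
      have hfe : f 0 ∈ e.source := hf0 ▸ e.map_target hz.1
      have hO : IsOpen (N ∩ f ⁻¹' e.source) :=
        hf.continuousOn.isOpen_inter_preimage hN e.open_source
      refine ⟨e ∘ f, ?_, by rw [Function.comp_apply, hf0, e.right_inv hz.1], ?_⟩
      · have h1 : ContMDiffAt (𝓡 (n * k)) (𝓡 (n * (k + 1))) ∞ (e ∘ f) 0 :=
          (hes.contMDiffAt (e.open_source.mem_nhds hfe)).comp 0 (hf.contMDiffAt (hN.mem_nhds h0N))
        exact h1.contDiffAt.of_le
          (show ((2 : ℕ∞) : WithTop ℕ∞) ≤ _ from WithTop.coe_le_coe.2 le_top)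
      · filter_upwards [hO.mem_nhds ⟨h0N, hfe⟩] with u hu
        have h1 : HasMFDerivAt (𝓡 (n * k)) (𝓡 (n * (k + 1))) (e ∘ f) u
            ((mfderiv (𝓡 (n * (k + 1))) (𝓡 (n * (k + 1))) e (f u)).comp
              (mfderiv (𝓡 (n * k)) (𝓡 (n * (k + 1))) f u)) :=
          (he.mdifferentiableAt hu.2).hasMFDerivAt.comp u
            (((hf.contMDiffAt (hN.mem_nhds hu.1)).mdifferentiableAt (by simp)).hasMFDerivAt)
        let A : EuclideanSpace ℝ (Fin (n * k)) →L[ℝ] EuclideanSpace ℝ (Fin (n * (k + 1))) :=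
          (mfderiv (𝓡 (n * (k + 1))) (𝓡 (n * (k + 1))) e (f u)).comp
            (mfderiv (𝓡 (n * k)) (𝓡 (n * (k + 1))) f u)
        have h2 : HasFDerivAt (e ∘ f) A u := hasMFDerivAt_iff_hasFDerivAt.1 h1
        rw [h2.fderiv, Function.comp_apply, V.inChart_apply e hu.2, ← (hfV u hu.1).2]
        exact LinearMap.range_comp _ _)
    (fun α z hz ↦ by
      obtain ⟨y, hy, rfl⟩ := hWe z hz
      rw [V.inChart_apply e hy]
      rintro _ ⟨v, hv, rfl⟩ _ ⟨w, hw, rfl⟩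
      exact ((Ω α).inChart_apply he hy v w).trans (h.isotropic α y v hv w hw))
    (fun z hz v hv ↦ by
      obtain ⟨y, hy, rfl⟩ := hWe z hz
      obtain ⟨v, rfl⟩ := he.mfderiv_surjective hy v
      have : v = 0 := h.ker_inter y v fun α w ↦ by
        rw [← (Ω α).inChart_apply he hy v w]
        exact hv α _
      rw [this]
      exact map_zero _)
  have hψm : ContMDiffOn (𝓡 (n * (k + 1))) 𝓘(ℝ, DarbouxSpace n k) ∞ ψ ψ.source :=
    hψ.contMDiffOn
  have hψsm : ContMDiffOn 𝓘(ℝ, DarbouxSpace n k) (𝓡 (n * (k + 1))) ∞ ψ.symm ψ.target :=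
    hψs.contMDiffOn
  have hφ : IsCoordinateSystem (m := n * (k + 1)) (e.trans ψ) :=
    ⟨hψm.comp (hes.mono fun y hy ↦ hy.1) fun y hy ↦ hy.2,
      het.comp (hψsm.mono fun z hz ↦ hz.1) fun z hz ↦ hz.2⟩
  have hφd : (e.trans ψ).MDifferentiable (𝓡 (n * (k + 1))) 𝓘(ℝ, DarbouxSpace n k) :=
    ⟨hφ.1.mdifferentiableOn (by simp), hφ.2.mdifferentiableOn (by simp)⟩
  refine ⟨e.trans ψ, ⟨hxe, hpψ⟩, hφ, fun y hy ↦ ?_⟩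
  have hye : y ∈ e.source := hy.1
  have hyψ : e y ∈ ψ.source := hy.2
  let D : TangentSpace (𝓡 (n * (k + 1))) y →L[ℝ] EuclideanSpace ℝ (Fin (n * (k + 1))) :=
    mfderiv (𝓡 (n * (k + 1))) (𝓡 (n * (k + 1))) e y
  have hψd : HasFDerivAt ψ (fderiv ℝ ψ (e y)) (e y) :=
    ((hψ.contDiffAt (ψ.open_source.mem_nhds hyψ)).differentiableAt (by simp)).hasFDerivAt
  have hcomp : ∀ {F : Type} [NormedAddCommGroup F] [NormedSpace ℝ F] (T : DarbouxSpace n k →L[ℝ] F),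
      HasMFDerivAt (𝓡 (n * (k + 1))) 𝓘(ℝ, F) (fun z ↦ T (e.trans ψ z)) y
        ((T ∘L fderiv ℝ ψ (e y)) ∘L D) := fun T ↦
    (T.hasFDerivAt.comp (e y) hψd).hasMFDerivAt.comp y (he.mdifferentiableAt hye).hasMFDerivAt
  have hdq : ∀ i v, dq (e.trans ψ) i y v = (fderiv ℝ ψ (e y) (D v)).1 i := fun i v ↦
    congrArg (fun A ↦ A v) (hcomp (ContinuousLinearMap.proj i ∘L .fst ℝ (Fin n → ℝ) _)).mfderiv
  have hdp : ∀ α i v, dp (e.trans ψ) α i y v = (fderiv ℝ ψ (e y) (D v)).2 α i := fun α i v ↦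
    congrArg (fun A ↦ A v) (hcomp (ContinuousLinearMap.proj i ∘L ContinuousLinearMap.proj α ∘L
      .snd ℝ (Fin n → ℝ) (Fin k → Fin n → ℝ))).mfderiv
  obtain ⟨hform, hVψ⟩ := hψform (e y) hyψ
  refine ⟨fun α v w ↦ ?_, ?_⟩
  · rw [← (Ω α).inChart_apply he hye v w]
    refine (hform α (D v) (D w)).trans ?_
    simp only [hdq, hdp]
  -- `V y` lies in the span of the coordinate vectors, which has dimension at most `nk`
  · have hle : V y ≤ Submodule.span ℝ
        (Set.range fun a : Fin k × Fin n ↦ partialP (m := n * (k + 1)) (e.trans ψ) a.1 a.2 y) := by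
      intro v hv
      have h1 : D v ∈ V.inChart e (e y) := by
        rw [V.inChart_apply e hye]
        exact ⟨v, hv, rfl⟩
      have h2 : (fderiv ℝ ψ (e y) (D v)).1 = 0 := (hVψ (D v)).1 h1
      let B : DarbouxSpace n k →L[ℝ] TangentSpace (𝓡 (n * (k + 1))) y :=
        mfderiv 𝓘(ℝ, DarbouxSpace n k) (𝓡 (n * (k + 1))) (e.trans ψ).symm (e.trans ψ y)
      have h3 : B (fderiv ℝ ψ (e y) (D v)) = v := by
        have h4 := congrArg (fun A ↦ A v) (hφd.symm_comp_deriv hy)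
        have h5 : mfderiv (𝓡 (n * (k + 1))) 𝓘(ℝ, DarbouxSpace n k) (e.trans ψ) y = _ :=
          (hcomp (.id ℝ (DarbouxSpace n k))).mfderiv
        rw [h5] at h4
        exact h4
      have h6 : fderiv ℝ ψ (e y) (D v) = ∑ a : Fin k × Fin n, (fderiv ℝ ψ (e y) (D v)).2 a.1 a.2 •
          ((0, Pi.single a.1 (Pi.single a.2 1)) : DarbouxSpace n k) := by
        refine Prod.ext ?_ ?_
        · rw [h2, Prod.fst_sum]
          simp
        · ext β j
          rw [Prod.snd_sum, Fintype.sum_prod_type]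
          simp [Finset.sum_apply, Pi.single_apply, ite_apply]
      rw [← h3, h6, map_sum]
      refine Submodule.sum_mem _ fun a _ ↦ ?_
      rw [map_smul]
      exact Submodule.smul_mem _ _ (Submodule.subset_span ⟨a, rfl⟩)
    have : FiniteDimensional ℝ (TangentSpace (𝓡 (n * (k + 1))) y) :=
      inferInstanceAs (FiniteDimensional ℝ (EuclideanSpace ℝ (Fin (n * (k + 1)))))
    refine Submodule.eq_of_le_of_finrank_le hle ?_
    rw [h.rank_distribution y]
    refine (finrank_range_le_card _).trans ?_
    simp [mul_comm]
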